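/- **Setting.** Let $S$ be a closed surface of genus at least two and $\rho_0:\pi_1S\to\mathrm{PSL}_2\mathbb R$ a Fuchsian representation, that is, an injective homomorphism with discrete image, together with the resulting identification $S\simeq\rho_0(\pi_1S)\backslash\mathbb H^2$, where $\mathbb H^2$ is the upper half-plane. Let $\iota:\mathrm{PSL}_2\mathbb C\to\mathrm{PSL}_3\mathbb C$ be a principal embedding (a conjugate of the embedding given by the irreducible representation of $\mathrm{SL}_2\mathbb C$ on $\mathrm{Sym}^2\mathbb C^2$), and let $\rho=\iota\circ\rho_0$ be the corresponding $\mathrm{PSL}_3\mathbb C$-Fuchsian representation, with image $\Gamma$. The groups $\mathrm{PSL}_2\mathbb R\subset\mathrm{PSL}_2\mathbb C$ act on the flag variety $\mathcal F=\{(\ell,H):\ell\in\mathbb P^2_{\mathbb C},\ H\subset\mathbb P^2_{\mathbb C}\text{ a projective line through }\ell\}$ through $\iota$. Let $\tilde\phi:\mathbb P^1_{\mathbb C}\to\mathcal F$ be the $\iota$-equivariant principal curve, $\tilde\phi(p)=(\phi(p),T_{\phi(p)}Y)$, where $Y=\phi(\mathbb P^1_{\mathbb C})$ is a conic and $T_yY$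 is its tangent line at $y$. The limit curve of $\rho$ is the image under $\tilde\phi$ of the limit set of $\rho_0(\pi_1S)$ in $\mathbb P^1_{\mathbb R}\subset\mathbb P^1_{\mathbb C}$. Let $\Lambda\subset\mathcal F$ be the set of all flags that have their point or their line in common with some flag of the limit curve, let $\Omega=\mathcal F\setminus\Lambda$, and let $\mathcal W=\Gamma\backslash\Omega$. Let $\Omega_0$ be the set of flags $(\ell,H)$ for which there are $p\ne q$ and $r\ne s$ in $\mathbb P^1_{\mathbb C}$ with $\ell\in T_{\phi(p)}Y\cap T_{\phi(q)}Y$ and $\phi(r),\phi(s)\in H$. Regard $\mathbb P^1_{\mathbb C}$ as the boundary at infinity of $\mathbb H^3$, write $\gamma_{p,q}$ for the geodesic with ideal endpoints $p,q$, and regard $\mathbb H^2$ as the totally geodesic plane in $\mathbb H^3$ preserved by $\mathrm{PSL}_2\mathbb R$. For $(\ell,H)\in\Omega_0$ with $p,q,r,s$ as above, the geodesics $\gamma_{p,q}$ and $\gamma_{r,s}$ meet in exactly one point; let $\tilde\pi(\ell,H)\in\mathbb H^2$ be the orthogonal projection of that point to $\mathbb H^2$. **Theorem.** $\Omega_0$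 is contained in $\Omega$, $\Omega$ is invariant under $\mathrm{PSL}_2\mathbb R$, and the map $\tilde\pi:\Omega_0\to\mathbb H^2$ extends to a proper $\mathrm{PSL}_2\mathbb R$-equivariant continuous map $\hat\pi:\Omega\to\mathbb H^2$. Moreover, there is a compact topological space $F$ such that: 1. $\hat\pi:\Omega\to\mathbb H^2$ is a $\mathrm{PSL}_2\mathbb R$-equivariant continuous fiber bundle with fiber $F$, where $\mathrm{PSL}_2\mathbb R$ acts continuously on $\Omega$; 2. $\Omega$ is homeomorphic to $\mathbb H^2\times F$; 3. $\mathcal W=\Gamma\backslash\Omega$ is a continuous fiber bundle over $S\simeq\rho_0(\pi_1S)\backslash\mathbb H^2$ with fiber $F$, and its projection $\mathcal W\to S$ is the map induced by $\hat\pi$. -/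

import Mathlib

open Topology UpperHalfPlane Matrix
open scoped MatrixGroups LinearAlgebra.Projectivization

noncomputable section

namespace SL3Fibering

/-! ### Projective spaces -/

/-- The quotient topology on a complex projective space. -/
instance projTopology (n : ℕ) : TopologicalSpace (ℙ ℂ (Fin n → ℂ)) :=
  inferInstanceAs
    (TopologicalSpace (Quotient (projectivizationSetoid ℂ (Fin n → ℂ))))

/-- The complex projective line; `[v₀ : v₁]` is the point `v₀ / v₁` of `ℂ ∪ {∞}`. -/
abbrev P1 : Type := ℙ ℂ (Fin 2 → ℂ)

/-- The real projective line inside the complex one. -/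
def RP1 : Set P1 :=
  {p | ∃ (v : Fin 2 → ℝ) (hv : (fun i => (v i : ℂ)) ≠ 0),
    p = Projectivization.mk ℂ (fun i => (v i : ℂ)) hv}

/-- The inclusion of the upper half-plane in the complex projective line. -/
def upperToP1 (z : ℍ) : P1 :=
  Projectivization.mk ℂ ![(z : ℂ), 1] (fun h => one_ne_zero (congrFun h 1))

/-! ### The groups and the principal embedding -/

/-- `PSL(2, ℝ)` acts on the upper half-plane by Möbius transformations. -/
instance pslActionUpperHalfPlane : MulAction PSL(2, ℝ) ℍ :=
  MulAction.compHom ℍ (Matrix.ProjectiveSpecialLinearGroup.toPGL (n := Fin 2) (R := ℝ))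

lemma map_mem_center {A : SL(2, ℝ)} (hA : A ∈ Subgroup.center SL(2, ℝ)) :
    Matrix.SpecialLinearGroup.map (algebraMap ℝ ℂ) A ∈ Subgroup.center SL(2, ℂ) := by
  obtain ⟨r, hr, hrA⟩ := Matrix.SpecialLinearGroup.mem_center_iff.mp hA
  refine Matrix.SpecialLinearGroup.mem_center_iff.mpr ⟨(r : ℂ), by exact_mod_cast hr, ?_⟩
  have h : ∀ i j, A i j = (Matrix.scalar (Fin 2) r) i j := fun i j => by rw [hrA]
  ext i j
  fin_cases i <;> fin_cases j <;> simp [h]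

/-- The inclusion of `PSL(2, ℝ)` in `PSL(2, ℂ)`. -/
def realToComplex : PSL(2, ℝ) →* PSL(2, ℂ) :=
  QuotientGroup.map _ _ (Matrix.SpecialLinearGroup.map (algebraMap ℝ ℂ))
    (fun _ hA => map_mem_center hA)

/-- The matrix of the symmetric square of `A` in the basis `e₁², e₁e₂, e₂²` of `Sym² ℂ²`. -/
def symSquareMatrix (A : Matrix (Fin 2) (Fin 2) ℂ) : Matrix (Fin 3) (Fin 3) ℂ :=
  !![A 0 0 ^ 2, A 0 0 * A 0 1, A 0 1 ^ 2;
     2 * (A 0 0 * A 1 0), A 0 0 * A 1 1 + A 0 1 * A 1 0, 2 * (A 0 1 * A 1 1);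
     A 1 0 ^ 2, A 1 0 * A 1 1, A 1 1 ^ 2]

/-- The three-dimensional irreducible representation of `SL(2, ℂ)`. -/
def symSquare : SL(2, ℂ) →* SL(3, ℂ) where
  toFun A := ⟨symSquareMatrix A.1, by
    have h := A.2
    rw [Matrix.det_fin_two] at h
    have : (symSquareMatrix A.1).det = (A.1 0 0 * A.1 1 1 - A.1 0 1 * A.1 1 0) ^ 3 := by
      simp [symSquareMatrix, Matrix.det_fin_three]
      ring
    rw [this, h, one_pow]⟩
  map_one' := Subtype.ext (by
    change symSquareMatrix 1 = 1
    ext i j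
    fin_cases i <;> fin_cases j <;> simp [symSquareMatrix])
  map_mul' A B := Subtype.ext (by
    change symSquareMatrix (A.1 * B.1) = symSquareMatrix A.1 * symSquareMatrix B.1
    ext i j
    fin_cases i <;> fin_cases j <;>
      simp [symSquareMatrix, Matrix.mul_apply, Fin.sum_univ_succ] <;> ring)

lemma symSquare_mem_center {A : SL(2, ℂ)} (hA : A ∈ Subgroup.center SL(2, ℂ)) :
    symSquare A ∈ Subgroup.center SL(3, ℂ) := by
  obtain ⟨r, hr, hrA⟩ := Matrix.SpecialLinearGroup.mem_center_iff.mp hA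
  have h : ∀ i j, A.1 i j = (Matrix.scalar (Fin 2) r) i j := fun i j => by rw [hrA]
  have hr' : r ^ 2 = 1 := by simpa using hr
  refine Matrix.SpecialLinearGroup.mem_center_iff.mpr ⟨1, by simp, ?_⟩
  change _ = symSquareMatrix A.1
  ext i j
  fin_cases i <;> fin_cases j <;> simp [symSquareMatrix, h, hr', ← sq]

/-- The standard principal embedding `PSL(2, ℂ) → PSL(3, ℂ)`. It takes upper triangular
(diagonal) matrices to upper triangular (diagonal) matrices. -/
def principal : PSL(2, ℂ) →* PSL(3, ℂ) :=
  QuotientGroup.map _ _ symSquare (fun _ hA => symSquare_mem_center hA)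

/-- The principal embedding conjugated by `g`. As `g` varies these are all the principal
embeddings of `PSL(2, ℂ)` in `PSL(3, ℂ)`. -/
def principalConj (g : PSL(3, ℂ)) : PSL(2, ℂ) →* PSL(3, ℂ) :=
  (MulAut.conj g).toMonoidHom.comp principal

/-! ### The flag variety -/

/-- The point `[x]` lies on the line `{ξ = 0}`, where `ξ` is the linear form whose coefficients are
the homogeneous coordinates of `H`. -/
def Incident (l H : ℙ ℂ (Fin 3 → ℂ)) : Prop := l.rep ⬝ᵥ H.rep = 0

lemma incident_mk {x y : Fin 3 → ℂ} (hx : x ≠ 0) (hy : y ≠ 0) :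
    Incident (Projectivization.mk ℂ x hx) (Projectivization.mk ℂ y hy) ↔ x ⬝ᵥ y = 0 := by
  obtain ⟨a, ha⟩ := Projectivization.exists_smul_eq_mk_rep ℂ x hx
  obtain ⟨b, hb⟩ := Projectivization.exists_smul_eq_mk_rep ℂ y hy
  unfold Incident
  rw [← ha, ← hb]
  simp [Units.smul_def]

/-- The variety of full flags in `ℂ³`: pairs `(l, H)` of a point `l` of the projective plane and
a projective line `H` through it. A line `H` is given by the coefficients, up to scale, of a
linear form that defines it. The topology is that of a subspace of the product. -/
def Flag : Type :=
  {x : ℙ ℂ (Fin 3 → ℂ) × ℙ ℂ (Fin 3 → ℂ) // Incident x.1 x.2}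

instance : TopologicalSpace Flag := inferInstanceAs (TopologicalSpace (Subtype _))

/-- The point of a flag. -/
def Flag.point (x : Flag) : ℙ ℂ (Fin 3 → ℂ) := x.1.1

/-- The line of a flag. -/
def Flag.line (x : Flag) : ℙ ℂ (Fin 3 → ℂ) := x.1.2

/-- The automorphism `A ↦ (A⁻¹)ᵀ` of `SL(3, ℂ)`. -/
def contragredientSL : SL(3, ℂ) →* SL(3, ℂ) where
  toFun A := A⁻¹.transpose
  map_one' := by
    apply Subtype.ext
    simp [Matrix.SpecialLinearGroup.coe_transpose]
  map_mul' A B := by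
    apply Subtype.ext
    simp [Matrix.SpecialLinearGroup.coe_transpose, Matrix.transpose_mul]

lemma transpose_mul_SL (A B : SL(3, ℂ)) : (A * B).transpose = B.transpose * A.transpose := by
  apply Subtype.ext
  simp [Matrix.SpecialLinearGroup.coe_transpose, Matrix.transpose_mul]

lemma contragredient_mem_center {A : SL(3, ℂ)} (hA : A ∈ Subgroup.center SL(3, ℂ)) :
    contragredientSL A ∈ Subgroup.center SL(3, ℂ) := by
  have hA' := Subgroup.mem_center_iff.mp ((Subgroup.center SL(3, ℂ)).inv_mem hA)
  refine Subgroup.mem_center_iff.mpr fun B => ?_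
  have hB : B = (B.transpose).transpose := by
    apply Subtype.ext
    simp [Matrix.SpecialLinearGroup.coe_transpose]
  change B * A⁻¹.transpose = A⁻¹.transpose * B
  rw [hB, ← transpose_mul_SL, ← transpose_mul_SL, hA' B.transpose]

/-- The automorphism of `PSL(3, ℂ)` induced by `A ↦ (A⁻¹)ᵀ`. -/
def contragredient : PSL(3, ℂ) →* PSL(3, ℂ) :=
  QuotientGroup.map _ _ contragredientSL (fun _ hA => contragredient_mem_center hA)

lemma incident_smul (g : PSL(3, ℂ)) {l H : ℙ ℂ (Fin 3 → ℂ)} (h : Incident l H) :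
    Incident (g • l) (contragredient g • H) := by
  induction g using QuotientGroup.induction_on with
  | H A =>
    induction l using Projectivization.ind with
    | h x hx =>
      induction H using Projectivization.ind with
      | h y hy =>
        have h' := (incident_mk hx hy).mp h
        change Incident (A • Projectivization.mk ℂ x hx)
          (A⁻¹.transpose • Projectivization.mk ℂ y hy)
        rw [Projectivization.smul_mk, Projectivization.smul_mk, incident_mk]
        change (A.1 *ᵥ x) ⬝ᵥ ((A⁻¹.transpose).1 *ᵥ y) = 0
        have hA : (A⁻¹).1 * A.1 = 1 := by
          rw [← Matrix.SpecialLinearGroup.coe_mul, inv_mul_cancel]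
          rfl
        rw [Matrix.SpecialLinearGroup.coe_transpose, Matrix.mulVec_transpose, dotProduct_comm,
          ← Matrix.dotProduct_mulVec, Matrix.mulVec_mulVec, hA, Matrix.one_mulVec,
          dotProduct_comm, h']

/-- `g` maps the flag `(l, H)` to `(g l, g H)`. The linear form `ξ` that defines `H` goes to
`ξ ∘ g⁻¹`, whose coefficient vector is `(g⁻¹)ᵀ ξ`. -/
instance : MulAction PSL(3, ℂ) Flag where
  smul g x := ⟨(g • x.1.1, contragredient g • x.1.2), incident_smul g x.2⟩
  one_smul x := by
    apply Subtype.ext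
    change ((1 : PSL(3, ℂ)) • x.1.1, contragredient 1 • x.1.2) = x.1
    rw [map_one, one_smul, one_smul]
  mul_smul g h x := by
    apply Subtype.ext
    change ((g * h) • x.1.1, contragredient (g * h) • x.1.2) =
      (g • h • x.1.1, contragredient g • contragredient h • x.1.2)
    rw [map_mul, mul_smul, mul_smul]

/-! ### The principal curve and the domain -/

lemma square_ne_zero {v : Fin 2 → ℂ} (hv : v ≠ 0) :
    ![v 0 ^ 2, 2 * (v 0 * v 1), v 1 ^ 2] ≠ 0 := by
  intro h
  apply hv
  have h0 := congrFun h 0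
  have h2 := congrFun h 2
  ext i
  fin_cases i
  · simpa using h0
  · simpa using h2

lemma tangent_ne_zero {v : Fin 2 → ℂ} (hv : v ≠ 0) :
    ![v 1 ^ 2, -(v 0 * v 1), v 0 ^ 2] ≠ 0 := by
  intro h
  apply hv
  have h0 := congrFun h 0
  have h2 := congrFun h 2
  ext i
  fin_cases i
  · simpa using h2
  · simpa using h0

/-- The principal rational curve of the standard principal embedding. The point `[v]` goes to
the flag of the point `[v²]` of the conic `{[v²]}` in the projective plane of `Sym² ℂ²` and the
tangent line of the conic there. The tangent line consists of the products `v u`, `u ∈ ℂ²`. -/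
def stdPrincipalCurve (p : P1) : Flag :=
  ⟨(Projectivization.mk ℂ _ (square_ne_zero p.rep_nonzero),
    Projectivization.mk ℂ _ (tangent_ne_zero p.rep_nonzero)), by
      rw [incident_mk]
      simp [dotProduct, Fin.sum_univ_succ]
      ring⟩

/-- The principal curve of the principal embedding `principalConj g`. -/
def principalCurve (g : PSL(3, ℂ)) (p : P1) : Flag := g • stdPrincipalCurve p

/-- The limit set of a homomorphism to `PSL(2, ℝ)`: the accumulation points of its orbits in the
upper half-plane on the boundary circle. -/
def limitSet {Γ : Type*} [Group Γ] (η : Γ →* PSL(2, ℝ)) : Set P1 :=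
  {t | t ∈ RP1 ∧ ∃ z : ℍ, t ∈ closure (Set.range fun γ : Γ => upperToP1 (η γ • z))}

/-- The thickening of a flag `x` for the balanced ideal `{e, α₁, α₂}` of the Weyl group `S₃`:
the flags that have the point or the line in common with `x`. -/
def thickening (x : Flag) : Set Flag := {y | y.point = x.point ∨ y.line = x.line}

/-- The domain of the representation `principalConj g ∘ η` in the flag variety: the complement of
the union of the thickenings of the points of its limit curve, where the limit curve is the image
of the limit set of `η` under the principal curve. -/
def domain {Γ : Type*} [Group Γ] (g : PSL(3, ℂ)) (η : Γ →* PSL(2, ℝ)) : Set Flag :=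
  (⋃ t ∈ limitSet η, thickening (principalCurve g t))ᶜ

/-! ### The divisor model and the open stratum -/

/-- The flag `ω = (l, H)` corresponds to the pair of divisors `(p + q, r + s)` with `p ≠ q` and
`r ≠ s`: the point `l` lies on the tangent lines to the conic at the images of `p` and `q`, and
the line `H` meets the conic at the images of `r` and `s`. -/
def HasDivisors (g : PSL(3, ℂ)) (ω : Flag) (p q r s : P1) : Prop :=
  p ≠ q ∧ r ≠ s ∧
    Incident ω.point (principalCurve g p).line ∧ Incident ω.point (principalCurve g q).line ∧
    Incident (principalCurve g r).point ω.line ∧ Incident (principalCurve g s).point ω.line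

/-- The open stratum: flags both of whose divisors are reduced. -/
def openStratum (g : PSL(3, ℂ)) : Set Flag := {ω | ∃ p q r s, HasDivisors g ω p q r s}

/-! ### Hyperbolic three-space -/

/-- The upper half-space model of hyperbolic 3-space: pairs `(z, t)` with `z` complex, `t > 0`.
Its boundary at infinity is `ℂ ∪ {∞} = P1`. -/
def H3 : Type := {x : ℂ × ℝ // 0 < x.2}

/-- The geodesic of hyperbolic 3-space with distinct ideal endpoints `p = [v]` and `q = [w]`.
For finite endpoints `a` and `b` the equation is `(z - a) * conj (z - b) + t² = 0`, the
semicircle over the segment from `a` to `b` that is orthogonal to the boundary; for `b = ∞` it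
is `z = a`, a vertical half-line. -/
def geodesic (p q : P1) : Set H3 :=
  {x | (p.rep 1 * x.1.1 - p.rep 0) * star (q.rep 1 * x.1.1 - q.rep 0) +
    p.rep 1 * star (q.rep 1) * (x.1.2 : ℂ) ^ 2 = 0}

/-- Orthogonal projection of hyperbolic 3-space to the totally geodesic plane `{Im z = 0}`, which
is identified with the upper half-plane by `(x, t) ↦ x + t i`. The geodesic through `(x + y i, t)`
orthogonal to the plane is the semicircle `{(x + y' i, t') | y' ^ 2 + t' ^ 2 = y ^ 2 + t ^ 2}`. -/
def orthProj (x : H3) : ℍ :=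
  ⟨⟨x.1.1.re, √(x.1.1.im ^ 2 + x.1.2 ^ 2)⟩, by
    have := x.2
    exact Real.sqrt_pos.mpr (by positivity)⟩

/-! ### Fuchsian representations, fiber bundles, quotients -/

/-- `η` is injective with discrete image. No orientation of the surface is involved. -/
def IsFuchsian {Γ : Type*} [Group Γ] (η : Γ →* PSL(2, ℝ)) : Prop :=
  Function.Injective η ∧ DiscreteTopology η.range

/-- `p` identifies `S` with the quotient surface of the upper half-plane by the image of `η`: it is
a covering map whose fibers are the orbits. -/
def IsUniformization {S Γ : Type*} [TopologicalSpace S] [Group Γ] (η : Γ →* PSL(2, ℝ))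
    (p : ℍ → S) : Prop :=
  IsCoveringMap p ∧ Function.Surjective p ∧ ∀ z w : ℍ, p z = p w ↔ ∃ γ, η γ • z = w

/-- `π : Z → B` is a (locally trivial, continuous) fiber bundle with fiber `F`. -/
def IsFiberBundle (F : Type*) {Z B : Type*} [TopologicalSpace F] [TopologicalSpace Z]
    [TopologicalSpace B] (π : Z → B) : Prop :=
  ∀ b : B, ∃ e : Bundle.Trivialization F π, b ∈ e.baseSet

/-- Two points of `Ω` are equivalent if they lie in the same `ρ`-orbit. -/
def orbitSetoid {Γ : Type*} [Group Γ] (ρ : Γ →* PSL(3, ℂ)) (Ω : Set Flag) : Setoid Ω where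
  r x y := ∃ γ, ρ γ • (x : Flag) = y
  iseqv :=
    { refl := fun x => ⟨1, by rw [map_one, one_smul]⟩
      symm := by
        rintro x y ⟨γ, h⟩
        exact ⟨γ⁻¹, by rw [map_inv, ← h, inv_smul_smul]⟩
      trans := by
        rintro x y z ⟨γ, h⟩ ⟨δ, h'⟩
        exact ⟨δ * γ, by rw [map_mul, mul_smul, h, h']⟩ }

/-- The quotient `ρ(Γ) \ Ω`, with the quotient topology. -/
abbrev OrbitQuotient {Γ : Type*} [Group Γ] (ρ : Γ →* PSL(3, ℂ)) (Ω : Set Flag) : Type :=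
  Quotient (orbitSetoid ρ Ω)

end SL3Fibering

end

open Topology UpperHalfPlane Matrix
open scoped MatrixGroups LinearAlgebra.Projectivization

noncomputable section

namespace SL3Fibering

open scoped ComplexConjugate

/-! ### Binary quadratic forms and Hermitian forms -/

/-! Positive semidefinite Hermitian 2×2 matrices up to scale form the closed ball H³ ∪ P¹, the
boundary point `v` being `v v*`. A point of the projective plane is a binary quadratic form, hence a
divisor p + q, and a line is likewise a divisor r + s. Incidence means that the two pairs are
harmonic (`symProd_dotProduct_secantForm`). A semidefinite Q lies on the closed geodesic from p to q
exactly when Q(p, q) = 0, and for p = q this leaves only the boundary point p. For harmonic pairs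
the two equations Q(p, q) = 0 = Q(r, s) have exactly one nonzero semidefinite solution up to scale,
even for non-reduced divisors (`exists_psd_herm_eq_zero`, `exists_forall_eq_smul`). So every flag
has a center in the closed ball, which on the open stratum is the intersection of the two geodesics.
The center is continuous because its graph is closed and the ball is compact (`continuous_center`).

Orthogonal projection to H² takes the real part of the matrix, so it makes sense wherever the real
part is definite, that is, off the real boundary points. The center of a flag is a boundary point v
exactly when the flag shares its point or its line with the principal curve at v. Hence the
projection is defined precisely off the thickening of the real curve (`mem_stdDomain_iff`). It is
proper because preimages of compact sets are closed in the compact flag variety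
(`isProperMap_proj`).

By cocompactness the limit set is the whole circle (`IsUniformization.limitSet_eq`), so the domain
is a translate of this standard one. A continuous section of the orbit map of `PSL(2, ℝ)` on the
upper half-plane trivializes every equivariant map to it, and properness makes the fiber over i
compact. The deck group acts freely, so the trivialization descends to the quotient along local
inverses of the covering. -/

/-- The determinant of a pair of vectors of the plane. -/
def bracket (u v : Fin 2 → ℂ) : ℂ := u 0 * v 1 - u 1 * v 0

/-- The product of two vectors in the symmetric square of the plane. -/
def symProd (u v : Fin 2 → ℂ) : Fin 3 → ℂ := ![u 0 * v 0, u 0 * v 1 + u 1 * v 0, u 1 * v 1]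

/-- The linear form on the symmetric square whose zero set is spanned by `u²` and `v²`. -/
def secantForm (u v : Fin 2 → ℂ) : Fin 3 → ℂ :=
  ![u 1 * v 1, -((u 0 * v 1 + u 1 * v 0) / 2), u 0 * v 0]

/-- The sesquilinear form of the Hermitian matrix with rows `(a, b)` and `(conj b, c)`, which is
encoded by the triple `(a, b, c)`, evaluated at the covectors `bracket · u` and `bracket · v`. -/
def herm (Q : ℝ × ℂ × ℝ) (u v : Fin 2 → ℂ) : ℂ :=
  Q.1 * (u 1 * conj (v 1)) - Q.2.1 * (u 1 * conj (v 0)) - conj Q.2.1 * (u 0 * conj (v 1)) +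
    Q.2.2 * (u 0 * conj (v 0))

/-- The triple `(a, b, c)` encodes a positive semidefinite Hermitian matrix. -/
def Psd (Q : ℝ × ℂ × ℝ) : Prop := 0 ≤ Q.1 ∧ 0 ≤ Q.2.2 ∧ Complex.normSq Q.2.1 ≤ Q.1 * Q.2.2

/-- The Hermitian matrix `v v*`. -/
def rankOne (v : Fin 2 → ℂ) : ℝ × ℂ × ℝ :=
  (Complex.normSq (v 0), v 0 * conj (v 1), Complex.normSq (v 1))

/-- A real function that vanishes at `symProd u v` if and only if `herm Q u v = 0`. -/
def defect (x : Fin 3 → ℂ) (Q : ℝ × ℂ × ℝ) : ℝ :=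
  2 * Q.2.2 ^ 2 * Complex.normSq (x 0) + 2 * Q.1 ^ 2 * Complex.normSq (x 2)
    + 4 * (x 0 * conj (x 2) * conj Q.2.1 ^ 2).re
    - 4 * Q.2.2 * (x 0 * conj (x 1) * conj Q.2.1).re
    - 4 * Q.1 * (x 2 * conj (x 1) * Q.2.1).re
    + Complex.normSq (x 1) * (Q.1 * Q.2.2 + Complex.normSq Q.2.1)
    - (Q.1 * Q.2.2 - Complex.normSq Q.2.1) * ‖x 1 ^ 2 - 4 * (x 0 * x 2)‖

/-- The polynomial part of `defect` is the permanent Q(u,u)Q(v,v) + |Q(u,v)|², the Hermitian form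
induced on the symmetric square. Subtracting the Gram determinant det Q · |[u,v]|², where [u,v]² is
the discriminant, leaves 2|Q(u,v)|². This expresses orthogonality of the roots continuously, without
choosing or ordering them. -/
lemma defect_symProd (u v : Fin 2 → ℂ) (Q : ℝ × ℂ × ℝ) :
    defect (symProd u v) Q = 2 * Complex.normSq (herm Q u v) := by
  obtain ⟨a, b, c⟩ := Q
  have h1 : (symProd u v 1 ^ 2 - 4 * (symProd u v 0 * symProd u v 2)) = bracket u v ^ 2 := by
    simp [symProd, bracket]; ring
  unfold defect
  rw [h1, norm_pow, ← Complex.normSq_eq_norm_sq]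
  generalize hu0 : u 0 = u0
  generalize hu1 : u 1 = u1
  generalize hv0 : v 0 = v0
  generalize hv1 : v 1 = v1
  obtain ⟨p, q⟩ := u0
  obtain ⟨r, s⟩ := u1
  obtain ⟨k, l⟩ := v0
  obtain ⟨m, n⟩ := v1
  obtain ⟨d, e⟩ := b
  simp [symProd, bracket, herm, hu0, hu1, hv0, hv1, Complex.normSq_apply, pow_two]
  ring

lemma defect_symProd_eq_zero (u v : Fin 2 → ℂ) (Q : ℝ × ℂ × ℝ) :
    defect (symProd u v) Q = 0 ↔ herm Q u v = 0 := by
  rw [defect_symProd]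
  simp

lemma defect_smul (k : ℂ) (x : Fin 3 → ℂ) (Q : ℝ × ℂ × ℝ) :
    defect (k • x) Q = Complex.normSq k * defect x Q := by
  have h : (k • x) 1 ^ 2 - 4 * ((k • x) 0 * (k • x) 2) = k ^ 2 * (x 1 ^ 2 - 4 * (x 0 * x 2)) := by
    simp; ring
  unfold defect
  rw [h, norm_mul, norm_pow, ← Complex.normSq_eq_norm_sq]
  simp only [Pi.smul_apply, smul_eq_mul, Complex.mul_re, Complex.mul_im, map_mul,
    Complex.conj_re, Complex.conj_im, pow_two]
  simp only [Complex.normSq_apply]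
  ring

lemma continuous_defect : Continuous fun y : (Fin 3 → ℂ) × (ℝ × ℂ × ℝ) => defect y.1 y.2 := by
  unfold defect
  have := Complex.continuous_normSq
  have := Complex.continuous_conj
  fun_prop

lemma exists_symProd_eq {x : Fin 3 → ℂ} (hx : x ≠ 0) :
    ∃ u v : Fin 2 → ℂ, u ≠ 0 ∧ v ≠ 0 ∧ x = symProd u v := by
  by_cases h0 : x 0 = 0
  · refine ⟨![0, 1], ![x 1, x 2], ?_, ?_, ?_⟩
    · intro h; simpa using congrFun h 1
    · intro h
      apply hx
      have h1 := congrFun h 0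
      have h2 := congrFun h 1
      ext i
      fin_cases i
      · exact h0
      · simpa using h1
      · simpa using h2
    · ext i
      fin_cases i <;> simp [symProd, h0]
  -- A square root of the discriminant; the quadratic formula gives the two linear factors.
  · obtain ⟨d, hd⟩ := IsAlgClosed.exists_pow_nat_eq (x 1 ^ 2 - 4 * (x 0 * x 2)) two_pos
    refine ⟨![1, (x 1 + d) / (2 * x 0)], ![x 0, (x 1 - d) / 2], ?_, ?_, ?_⟩
    · intro h; simpa using congrFun h 0
    · intro h; exact h0 (by simpa using congrFun h 0)
    · ext i
      fin_cases i
      · simp [symProd]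
      · simp [symProd]; field_simp; ring
      · simp [symProd]; field_simp; linear_combination hd

lemma exists_secantForm_eq {y : Fin 3 → ℂ} (hy : y ≠ 0) :
    ∃ u v : Fin 2 → ℂ, u ≠ 0 ∧ v ≠ 0 ∧ y = secantForm u v := by
  -- This triple is the quadratic form dual to `y` under the invariant pairing, which turns
  -- `secantForm u v` into `symProd u v`.
  obtain ⟨u, v, hu, hv, h⟩ := exists_symProd_eq (x := ![y 2, -2 * y 1, y 0]) (by
    intro h
    apply hy
    have h0 := congrFun h 0
    have h1 := congrFun h 1
    have h2 := congrFun h 2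
    ext i
    fin_cases i
    · simpa using h2
    · simpa using h1
    · simpa using h0)
  refine ⟨u, v, hu, hv, ?_⟩
  have h0 := congrFun h 0
  have h1 := congrFun h 1
  have h2 := congrFun h 2
  simp [symProd] at h0 h1 h2
  ext i
  fin_cases i
  · simp [secantForm, h2]
  · simp [secantForm, ← h1]; ring
  · simp [secantForm, h0]

/-- This is the polarized invariant pairing of binary quadratic forms. Its vanishing says that the
pairs {p, q} and {r, s} are harmonic. -/
lemma symProd_dotProduct_secantForm (p q r s : Fin 2 → ℂ) :
    2 * (symProd p q ⬝ᵥ secantForm r s) =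
      bracket p r * bracket q s + bracket p s * bracket q r := by
  simp [symProd, secantForm, bracket, dotProduct, Fin.sum_univ_succ]
  ring

lemma symProd_dotProduct_tangent (p q u : Fin 2 → ℂ) :
    symProd p q ⬝ᵥ ![u 1 ^ 2, -(u 0 * u 1), u 0 ^ 2] = bracket p u * bracket q u := by
  simp [symProd, bracket, dotProduct, Fin.sum_univ_succ]
  ring

lemma square_dotProduct_secantForm (r s u : Fin 2 → ℂ) :
    ![u 0 ^ 2, 2 * (u 0 * u 1), u 1 ^ 2] ⬝ᵥ secantForm r s = bracket r u * bracket s u := by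
  simp [secantForm, bracket, dotProduct, Fin.sum_univ_succ]
  ring

lemma bracket_self (u : Fin 2 → ℂ) : bracket u u = 0 := by
  unfold bracket; ring

lemma bracket_swap (u v : Fin 2 → ℂ) : bracket u v = -bracket v u := by
  unfold bracket; ring

lemma bracket_eq_zero_iff {u v : Fin 2 → ℂ} (hu : u ≠ 0) :
    bracket u v = 0 ↔ ∃ k : ℂ, v = k • u := by
  constructor
  · intro h
    unfold bracket at h
    by_cases h0 : u 0 = 0
    · have h1 : u 1 ≠ 0 := fun h1 => hu (by ext i; fin_cases i <;> simp [h0, h1])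
      refine ⟨v 1 / u 1, ?_⟩
      ext i
      fin_cases i
      · simp [h0] at h ⊢
        tauto
      · simp [h1]
    · refine ⟨v 0 / u 0, ?_⟩
      ext i
      fin_cases i
      · simp [h0]
      · simp; field_simp; linear_combination h
  · rintro ⟨k, rfl⟩
    simp [bracket]; ring

lemma herm_conj (Q : ℝ × ℂ × ℝ) (u v : Fin 2 → ℂ) : conj (herm Q u v) = herm Q v u := by
  simp [herm]; ring

lemma herm_rankOne (w u v : Fin 2 → ℂ) :
    herm (rankOne w) u v = bracket w u * conj (bracket w v) := by
  simp [herm, rankOne, bracket, Complex.normSq_eq_conj_mul_self]; ring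

lemma herm_smul_real (t : ℝ) (Q : ℝ × ℂ × ℝ) (u v : Fin 2 → ℂ) :
    herm (t • Q) u v = t * herm Q u v := by
  simp [herm]; ring

lemma herm_add (Q R : ℝ × ℂ × ℝ) (u v : Fin 2 → ℂ) :
    herm (Q + R) u v = herm Q u v + herm R u v := by
  simp [herm]; ring

lemma herm_smul_right (k : ℂ) (Q : ℝ × ℂ × ℝ) (u v : Fin 2 → ℂ) :
    herm Q u (k • v) = conj k * herm Q u v := by
  simp [herm]; ring

lemma herm_self_eq (Q : ℝ × ℂ × ℝ) (u : Fin 2 → ℂ) : herm Q u u = ((herm Q u u).re : ℂ) :=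
  (Complex.conj_eq_iff_re.mp (herm_conj Q u u)).symm

/-- Gram determinant: changing the basis multiplies the determinant of the form by |[u,v]|². -/
lemma herm_det (Q : ℝ × ℂ × ℝ) (u v : Fin 2 → ℂ) :
    herm Q u u * herm Q v v - herm Q u v * herm Q v u =
      ((Q.1 * Q.2.2 - Complex.normSq Q.2.1 : ℝ) : ℂ) * (bracket u v * conj (bracket u v)) := by
  simp [herm, bracket, Complex.normSq_eq_conj_mul_self]; ring

/-! ### Positive semidefinite forms -/

lemma psd_rankOne (v : Fin 2 → ℂ) : Psd (rankOne v) :=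
  ⟨Complex.normSq_nonneg _, Complex.normSq_nonneg _, by simp [rankOne]⟩

lemma Psd.smul {Q : ℝ × ℂ × ℝ} (hQ : Psd Q) {t : ℝ} (ht : 0 ≤ t) : Psd (t • Q) := by
  obtain ⟨h1, h2, h3⟩ := hQ
  refine ⟨mul_nonneg ht h1, mul_nonneg ht h2, ?_⟩
  simp [Complex.normSq_mul]
  nlinarith [mul_le_mul_of_nonneg_left h3 (mul_nonneg ht ht)]

/-- Positive semidefiniteness in terms of the associated form. -/
lemma psd_iff_herm (Q : ℝ × ℂ × ℝ) : Psd Q ↔ ∀ u, 0 ≤ (herm Q u u).re := by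
  obtain ⟨a, b, c⟩ := Q
  constructor
  · rintro ⟨h1, h2, h3⟩ u
    simp only at h1 h2 h3
    -- Completing the square.
    have key : a * (herm (a, b, c) u u).re = Complex.normSq (a * u 1 - conj b * u 0)
        + (a * c - Complex.normSq b) * Complex.normSq (u 0) := by
      simp [herm, Complex.normSq_apply]; ring
    rcases h1.eq_or_lt with ha | ha
    · subst ha
      have hb : b = 0 := by
        rw [← Complex.normSq_eq_zero]
        exact le_antisymm (by simpa using h3) (Complex.normSq_nonneg _)
      subst hb
      simp [herm]
      nlinarith [mul_nonneg h2 (Complex.normSq_nonneg (u 0)), Complex.normSq_apply (u 0)]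
    · have : 0 ≤ a * (herm (a, b, c) u u).re := by
        rw [key]
        exact add_nonneg (Complex.normSq_nonneg _)
          (mul_nonneg (by linarith) (Complex.normSq_nonneg _))
      exact nonneg_of_mul_nonneg_right this ha
  · intro h
    have ha : 0 ≤ a := by simpa [herm] using h ![0, 1]
    have hc : 0 ≤ c := by simpa [herm] using h ![1, 0]
    refine ⟨ha, hc, ?_⟩
    simp only
    -- These two test vectors yield a · det and c · det, so a negative determinant forces a = c = 0.
    -- The form is then purely off-diagonal and takes a negative value.
    have h1 := h ![a, conj b]
    have h2 := h ![b, c]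
    have e1 : (herm (a, b, c) ![(a : ℂ), conj b] ![(a : ℂ), conj b]).re
        = a * (a * c - Complex.normSq b) := by
      simp [herm, Complex.normSq_apply]; ring
    have e2 : (herm (a, b, c) ![b, (c : ℂ)] ![b, (c : ℂ)]).re
        = c * (a * c - Complex.normSq b) := by
      simp [herm, Complex.normSq_apply]; ring
    rw [e1] at h1
    rw [e2] at h2
    by_contra hlt
    push Not at hlt
    have ha0 : a = 0 := by nlinarith
    have hc0 : c = 0 := by nlinarith
    subst ha0 hc0
    have h3 := h ![b, 1]
    have h4 := h ![-b, 1]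
    simp [herm] at h3 h4
    simp [Complex.normSq_apply] at hlt
    nlinarith

lemma Psd.add {Q R : ℝ × ℂ × ℝ} (hQ : Psd Q) (hR : Psd R) : Psd (Q + R) := by
  rw [psd_iff_herm] at *
  intro u
  rw [herm_add]
  exact add_nonneg (hQ u) (hR u)

/-- Cauchy–Schwarz: the Gram determinant is nonnegative, so an isotropic vector lies in the kernel.
-/
lemma Psd.herm_eq_zero {Q : ℝ × ℂ × ℝ} (hQ : Psd Q) {u : Fin 2 → ℂ} (hu : herm Q u u = 0)
    (v : Fin 2 → ℂ) : herm Q u v = 0 := by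
  have h := herm_det Q u v
  rw [hu, zero_mul, zero_sub, ← herm_conj Q u v, Complex.mul_conj, Complex.mul_conj] at h
  have h' : -Complex.normSq (herm Q u v) =
      (Q.1 * Q.2.2 - Complex.normSq Q.2.1) * Complex.normSq (bracket u v) := by exact_mod_cast h
  have := mul_nonneg (sub_nonneg.mpr hQ.2.2) (Complex.normSq_nonneg (bracket u v))
  exact Complex.normSq_eq_zero.mp (le_antisymm (by linarith) (Complex.normSq_nonneg _))

/-- Since u is in the kernel, testing it against a basis gives linear equations whose only solutions
are the multiples of `u u*`. Geometrically, the degenerate geodesic from u to u is the boundary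
point u. -/
lemma Psd.eq_smul_rankOne {Q : ℝ × ℂ × ℝ} (hQ : Psd Q) {u : Fin 2 → ℂ} (hu0 : u ≠ 0)
    (hu : herm Q u u = 0) : ∃ t : ℝ, Q = t • rankOne u := by
  have h0 := hQ.herm_eq_zero hu ![1, 0]
  have h1 := hQ.herm_eq_zero hu ![0, 1]
  obtain ⟨a, b, c⟩ := Q
  simp [herm] at h0 h1
  by_cases hu1 : u 1 = 0
  · have h00 : u 0 ≠ 0 := fun h00 => hu0 (by ext i; fin_cases i <;> simp [h00, hu1])
    simp [hu1, h00] at h0 h1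
    refine ⟨a / Complex.normSq (u 0), ?_⟩
    simp [rankOne, hu1, h0, h1, h00]
  · refine ⟨c / Complex.normSq (u 1), ?_⟩
    have hn : (Complex.normSq (u 1) : ℂ) ≠ 0 := by simpa using hu1
    have hn' : Complex.normSq (u 1) ≠ 0 := by simpa using hu1
    have hb : b = c * u 0 / u 1 := by field_simp; linear_combination -h0
    have hcb : conj b = c * conj (u 0) / conj (u 1) := by rw [hb]; simp
    have hc1 : conj (u 1) ≠ 0 := by simpa using hu1
    have ha : (a : ℂ) = c * (u 0 * conj (u 0)) / (u 1 * conj (u 1)) := by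
      rw [hcb] at h1
      field_simp at h1 ⊢
      linear_combination h1
    refine Prod.ext ?_ (Prod.ext ?_ ?_)
    · rw [Complex.mul_conj, Complex.mul_conj] at ha
      simp only [rankOne, Prod.smul_fst, smul_eq_mul]
      have : a = c * Complex.normSq (u 0) / Complex.normSq (u 1) := by exact_mod_cast ha
      rw [this]; ring
    · simp [rankOne]
      rw [hb, Complex.normSq_eq_conj_mul_self]
      field_simp
    · simp [rankOne]
      field_simp

/-- Expansion of a Hermitian form in a basis of two covectors. -/
lemma smul_eq_of_herm_eq_zero {Q : ℝ × ℂ × ℝ} {p q : Fin 2 → ℂ} (h : herm Q p q = 0) :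
    Complex.normSq (bracket p q) • Q =
      (herm Q q q).re • rankOne p + (herm Q p p).re • rankOne q := by
  have h' : herm Q q p = 0 := by rw [← herm_conj, h, map_zero]
  have hp := herm_self_eq Q p
  have hq := herm_self_eq Q q
  obtain ⟨a, b, c⟩ := Q
  have e1 : ((Complex.normSq (bracket p q) * a : ℝ) : ℂ) =
      (((herm (a, b, c) q q).re * Complex.normSq (p 0) +
        (herm (a, b, c) p p).re * Complex.normSq (q 0) : ℝ) : ℂ) := by
    push_cast
    rw [← hp, ← hq]
    simp only [Complex.normSq_eq_conj_mul_self, bracket, map_sub, map_mul]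
    -- The general expansion of Q also has mixed terms in p and q. They vanish here, and restoring
    -- them leaves a polynomial identity.
    have : (0 : ℂ) = p 0 * conj (q 0) * herm (a, b, c) q p + conj (p 0) * q 0 * herm (a, b, c) p q := by
      rw [h, h']; ring
    rw [← add_zero (_ * (a : ℂ)), this]
    simp only [herm]
    ring
  have e2 : (Complex.normSq (bracket p q) : ℂ) * b =
      ((herm (a, b, c) q q).re : ℂ) * (p 0 * conj (p 1)) +
        ((herm (a, b, c) p p).re : ℂ) * (q 0 * conj (q 1)) := by
    rw [← hp, ← hq]
    simp only [Complex.normSq_eq_conj_mul_self, bracket, map_sub, map_mul]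
    have : (0 : ℂ) = p 0 * conj (q 1) * herm (a, b, c) q p + conj (p 1) * q 0 * herm (a, b, c) p q := by
      rw [h, h']; ring
    rw [← add_zero (_ * b), this]
    simp only [herm]
    ring
  have e3 : ((Complex.normSq (bracket p q) * c : ℝ) : ℂ) =
      (((herm (a, b, c) q q).re * Complex.normSq (p 1) +
        (herm (a, b, c) p p).re * Complex.normSq (q 1) : ℝ) : ℂ) := by
    push_cast
    rw [← hp, ← hq]
    simp only [Complex.normSq_eq_conj_mul_self, bracket, map_sub, map_mul]
    have : (0 : ℂ) = p 1 * conj (q 1) * herm (a, b, c) q p + conj (p 1) * q 1 * herm (a, b, c) p q := by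
      rw [h, h']; ring
    rw [← add_zero (_ * (c : ℂ)), this]
    simp only [herm]
    ring
  refine Prod.ext ?_ (Prod.ext ?_ ?_)
  · exact Complex.ofReal_injective (by simpa [rankOne] using e1)
  · simpa [rankOne] using e2
  · exact Complex.ofReal_injective (by simpa [rankOne] using e3)

lemma rankOne_trace_pos {v : Fin 2 → ℂ} (hv : v ≠ 0) : 0 < (rankOne v).1 + (rankOne v).2.2 := by
  by_cases h0 : v 0 = 0
  · have h1 : v 1 ≠ 0 := fun h1 => hv (by ext i; fin_cases i <;> simp [h0, h1])
    exact add_pos_of_nonneg_of_pos (Complex.normSq_nonneg _) (Complex.normSq_pos.mpr h1)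
  · exact add_pos_of_pos_of_nonneg (Complex.normSq_pos.mpr h0) (Complex.normSq_nonneg _)

/-- p and q form a basis, so by Cramer's rule a nonzero s cannot be proportional to both. -/
lemma normSq_bracket_add_pos {p q s : Fin 2 → ℂ} (hs : s ≠ 0) (hpq : bracket p q ≠ 0) :
    0 < Complex.normSq (bracket q s) + Complex.normSq (bracket p s) := by
  have h4 := Complex.normSq_nonneg (bracket q s)
  have h5 := Complex.normSq_nonneg (bracket p s)
  refine lt_of_le_of_ne (add_nonneg h4 h5) fun h0 => ?_
  have h6 : Complex.normSq (bracket q s) = 0 := by linarith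
  have h7 : Complex.normSq (bracket p s) = 0 := by linarith
  rw [Complex.normSq_eq_zero] at h6 h7
  apply hs
  simp only [bracket] at h6 h7 hpq
  ext i
  fin_cases i
  · exact (mul_eq_zero.mp (show (p 0 * q 1 - p 1 * q 0) * s 0 = 0 by
      linear_combination q 0 * h7 - p 0 * h6)).resolve_left hpq
  · exact (mul_eq_zero.mp (show (p 0 * q 1 - p 1 * q 0) * s 1 = 0 by
      linear_combination q 1 * h7 - p 1 * h6)).resolve_left hpq

/-! ### Centers of harmonic quadruples -/

/-- For a harmonic quadruple there is a Hermitian form that makes both pairs orthogonal. -/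
lemma exists_psd_herm_eq_zero {p q r s : Fin 2 → ℂ} (hp : p ≠ 0) (hq : q ≠ 0) (hs : s ≠ 0)
    (h : bracket p r * bracket q s + bracket p s * bracket q r = 0) :
    ∃ Q, Psd Q ∧ 0 < Q.1 + Q.2.2 ∧ herm Q p q = 0 ∧ herm Q r s = 0 := by
  by_cases hpq : bracket p q = 0
  · refine ⟨rankOne p, psd_rankOne p, rankOne_trace_pos hp, ?_, ?_⟩
    · rw [herm_rankOne, bracket_self, zero_mul]
    · rw [herm_rankOne]
      obtain ⟨k, rfl⟩ := (bracket_eq_zero_iff hp).mp hpq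
      have hk : k ≠ 0 := by rintro rfl; simp at hq
      -- With q = k p, harmonicity says that r or s is proportional to p, so the boundary point p
      -- lies on both geodesics.
      have h2 : 2 * k * (bracket p r * bracket p s) = 0 := by
        rw [← h]; simp [bracket]; ring
      simp only [mul_eq_zero, OfNat.ofNat_ne_zero, hk, false_or] at h2
      rcases h2 with h2 | h2 <;> simp [h2]
  -- The forms α pp* + β qq* make p and q orthogonal. With these weights the value at (r, s) is the
  -- harmonic relation times conj([q,s][p,s]).
  · refine ⟨Complex.normSq (bracket q s) • rankOne p + Complex.normSq (bracket p s) • rankOne q,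
      ((psd_rankOne p).smul (Complex.normSq_nonneg _)).add
        ((psd_rankOne q).smul (Complex.normSq_nonneg _)), ?_, ?_, ?_⟩
    · have h1 := normSq_bracket_add_pos hs hpq
      have h2 := rankOne_trace_pos hp
      have h3 := rankOne_trace_pos hq
      have h4 := Complex.normSq_nonneg (bracket q s)
      have h5 := Complex.normSq_nonneg (bracket p s)
      have h6 : 0 < Complex.normSq (bracket q s) * ((rankOne p).1 + (rankOne p).2.2) +
          Complex.normSq (bracket p s) * ((rankOne q).1 + (rankOne q).2.2) := by
        rcases h4.eq_or_lt with h4' | h4'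
        · rw [← h4', zero_add] at h1
          have := mul_pos h1 h3
          have := mul_nonneg h4 h2.le
          linarith
        · have := mul_pos h4' h2
          have := mul_nonneg h5 h3.le
          linarith
      simp only [Prod.fst_add, Prod.snd_add, Prod.smul_fst, Prod.smul_snd, smul_eq_mul]
      linarith
    · simp [herm_add, herm_smul_real, herm_rankOne, bracket_self]
    · simp only [herm_add, herm_smul_real, herm_rankOne, Complex.normSq_eq_conj_mul_self]
      linear_combination conj (bracket q s) * conj (bracket p s) * h

/-- A form for which both pairs of a harmonic quadruple are orthogonal is unique up to scale. -/
lemma exists_forall_eq_smul {p q r s : Fin 2 → ℂ} (hp : p ≠ 0) (hr : r ≠ 0) (hs : s ≠ 0)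
    (hq : q ≠ 0) (h : bracket p r * bracket q s + bracket p s * bracket q r = 0) :
    ∃ Q₀ : ℝ × ℂ × ℝ, ∀ Q, Psd Q → herm Q p q = 0 → herm Q r s = 0 → ∃ t : ℝ, Q = t • Q₀ := by
  by_cases hpq : bracket p q = 0
  · refine ⟨rankOne p, fun Q hQ h1 _ => hQ.eq_smul_rankOne hp ?_⟩
    obtain ⟨k, rfl⟩ := (bracket_eq_zero_iff hp).mp hpq
    have hk : k ≠ 0 := by rintro rfl; simp at hq
    rw [herm_smul_right] at h1
    simpa [hk] using h1
  · refine ⟨Complex.normSq (bracket q s) • rankOne p + Complex.normSq (bracket p s) • rankOne q,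
      fun Q hQ h1 h2 => ?_⟩
    have hN : Complex.normSq (bracket p q) ≠ 0 := by simpa using hpq
    have hS := normSq_bracket_add_pos hs hpq
    have hR := normSq_bracket_add_pos hr hpq
    have key := smul_eq_of_herm_eq_zero h1
    set α := (herm Q q q).re
    set β := (herm Q p p).re
    have h3 : (α : ℂ) * (bracket p r * conj (bracket p s)) +
        β * (bracket q r * conj (bracket q s)) = 0 := by
      have := congrArg (fun Q => herm Q r s) key
      simp only [herm_add, herm_smul_real, herm_rankOne, h2, mul_zero] at this
      exact this.symm
    -- `h` and `h3` are two linear relations between [p,r] and [q,r]. Eliminating either unknown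
    -- leaves the other times their determinant, and the two unknowns do not both vanish.
    have e1 : bracket q r * ((α * Complex.normSq (bracket p s) -
        β * Complex.normSq (bracket q s) : ℝ) : ℂ) = 0 := by
      push_cast
      simp only [Complex.normSq_eq_conj_mul_self]
      linear_combination (α : ℂ) * conj (bracket p s) * h - bracket q s * h3
    have e2 : bracket p r * ((α * Complex.normSq (bracket p s) -
        β * Complex.normSq (bracket q s) : ℝ) : ℂ) = 0 := by
      push_cast
      simp only [Complex.normSq_eq_conj_mul_self]
      linear_combination bracket p s * h3 - (β : ℂ) * conj (bracket q s) * h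
    have e3 : α * Complex.normSq (bracket p s) = β * Complex.normSq (bracket q s) := by
      rw [← sub_eq_zero]
      by_contra hne
      have hne' : ((α * Complex.normSq (bracket p s) -
        β * Complex.normSq (bracket q s) : ℝ) : ℂ) ≠ 0 := by exact_mod_cast hne
      have f1 := (mul_eq_zero.mp e1).resolve_right hne'
      have f2 := (mul_eq_zero.mp e2).resolve_right hne'
      simp [f1, f2] at hR
    -- The weight pairs (α, β) and (|[q,s]|², |[p,s]|²) are proportional. The ratio is taken between
    -- their sums because a single entry of the second pair may be zero.
    refine ⟨(α + β) / ((Complex.normSq (bracket q s) + Complex.normSq (bracket p s)) *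
      Complex.normSq (bracket p q)), ?_⟩
    have e4 : (Complex.normSq (bracket q s) + Complex.normSq (bracket p s)) •
        (Complex.normSq (bracket p q) • Q) = (α + β) • (Complex.normSq (bracket q s) • rankOne p +
          Complex.normSq (bracket p s) • rankOne q) := by
      rw [key]
      simp only [smul_add, smul_smul]
      congr 2
      · linear_combination e3
      · linear_combination -e3
    rw [div_eq_inv_mul, mul_smul, ← e4, smul_smul, smul_smul, mul_assoc,
      inv_mul_cancel₀, one_smul]
    exact mul_ne_zero hS.ne' hN

/-- A degenerate form for which both pairs of a harmonic quadruple are orthogonal. -/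
lemma bracket_eq_zero_of_herm_rankOne {p q r s v : Fin 2 → ℂ}
    (hv : v ≠ 0) (hp : p ≠ 0) (hq : q ≠ 0) (hr : r ≠ 0) (hs : s ≠ 0)
    (h : bracket p r * bracket q s + bracket p s * bracket q r = 0)
    (h1 : herm (rankOne v) p q = 0) (h2 : herm (rankOne v) r s = 0) :
    (bracket v p = 0 ∧ bracket v q = 0) ∨ (bracket v r = 0 ∧ bracket v s = 0) := by
  -- If one member of each pair is v, harmonicity forces a third member to be v, which completes one
  -- of the pairs.
  have aux : ∀ {p q r s : Fin 2 → ℂ}, p ≠ 0 → r ≠ 0 →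
      bracket p r * bracket q s + bracket p s * bracket q r = 0 → bracket v p = 0 →
      bracket v r = 0 → bracket v q = 0 ∨ bracket v s = 0 := by
    intro p q r s hp hr h e1 e2
    obtain ⟨k, rfl⟩ := (bracket_eq_zero_iff hv).mp e1
    obtain ⟨l, rfl⟩ := (bracket_eq_zero_iff hv).mp e2
    have hk : k ≠ 0 := by rintro rfl; simp at hp
    have hl : l ≠ 0 := by rintro rfl; simp at hr
    have : k * l * (bracket v s * bracket v q) = 0 := by
      unfold bracket at h ⊢
      simp only [Pi.smul_apply, smul_eq_mul] at h
      linear_combination -h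
    simp only [mul_eq_zero, hk, hl, false_or] at this
    tauto
  rw [herm_rankOne, mul_eq_zero, map_eq_zero] at h1 h2
  rcases h1 with h1 | h1 <;> rcases h2 with h2 | h2
  · have := aux (q := q) (s := s) hp hr h h1 h2
    tauto
  · have := aux (q := q) (s := r) hp hs (by linear_combination h) h1 h2
    tauto
  · have := aux (q := p) (s := s) hq hr (by linear_combination h) h1 h2
    tauto
  · have := aux (q := p) (s := r) hq hs (by linear_combination h) h1 h2
    tauto

/-- A singular nonzero form has rank one and is spanned by its second column (b, c), or by (1, 0) if
c = 0. The reality clause is what locates the boundary point on the real circle. -/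
lemma Psd.exists_eq_rankOne {Q : ℝ × ℂ × ℝ} (hQ : Psd Q) (hQ0 : 0 < Q.1 + Q.2.2)
    (hdet : Q.1 * Q.2.2 ≤ Complex.normSq Q.2.1) : ∃ v, v ≠ 0 ∧ ∃ t : ℝ, t ≠ 0 ∧
      Q = t • rankOne v ∧ (Q.2.1.im = 0 → ∀ i, (v i).im = 0) := by
  obtain ⟨a, b, c⟩ := Q
  obtain ⟨h1, h2, h3⟩ := hQ
  simp only at *
  have h4 : a * c = Complex.normSq b := le_antisymm hdet h3
  by_cases hc : c = 0
  · subst hc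
    have hb : b = 0 := by simpa using h4.symm
    subst hb
    refine ⟨![1, 0], fun h => by simpa using congrFun h 0, a, by linarith, ?_, ?_⟩
    · simp [rankOne]
    · intro _ i
      fin_cases i <;> simp
  · refine ⟨![b, c], fun h => hc (by simpa using congrFun h 1), c⁻¹, inv_ne_zero hc, ?_, ?_⟩
    · refine Prod.ext ?_ (Prod.ext ?_ ?_)
      · simp [rankOne]
        rw [← h4]; field_simp
      · have hc' : (c : ℂ) ≠ 0 := by exact_mod_cast hc
        simp [rankOne]; field_simp
      · simp [rankOne, Complex.normSq_apply]; field_simp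
    · intro hb i
      fin_cases i <;> simp [hb]

/-! ### Flags as harmonic quadruples and their centers -/

lemma symProd_ne_zero {u v : Fin 2 → ℂ} (hu : u ≠ 0) (hv : v ≠ 0) : symProd u v ≠ 0 := by
  intro h
  have h0 := congrFun h 0
  have h1 := congrFun h 1
  have h2 := congrFun h 2
  simp [symProd] at h0 h1 h2
  apply hv
  by_cases hu0 : u 0 = 0
  · have hu1 : u 1 ≠ 0 := fun hu1 => hu (by ext i; fin_cases i <;> simp [hu0, hu1])
    simp [hu0, hu1] at h1 h2
    ext i; fin_cases i <;> simp [h1, h2]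
  · simp [hu0] at h0
    simp [hu0, h0] at h1
    ext i; fin_cases i <;> simp [h1, h0]

lemma secantForm_ne_zero {u v : Fin 2 → ℂ} (hu : u ≠ 0) (hv : v ≠ 0) : secantForm u v ≠ 0 := by
  intro h
  apply symProd_ne_zero hu hv
  have h0 := congrFun h 0
  have h1 := congrFun h 1
  have h2 := congrFun h 2
  simp [secantForm] at h0 h1 h2
  ext i
  fin_cases i
  · simpa [symProd] using h2
  · simpa [symProd] using h1
  · simpa [symProd] using h0

/-- The divisors of `ω` are `[p] + [q]` and `[r] + [s]`. -/
structure IsQuadruple (ω : Flag) (p q r s : Fin 2 → ℂ) : Prop where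
  left : p ≠ 0
  left' : q ≠ 0
  right : r ≠ 0
  right' : s ≠ 0
  point_eq : ω.point = Projectivization.mk ℂ _ (symProd_ne_zero left left')
  line_eq : ω.line = Projectivization.mk ℂ _ (secantForm_ne_zero right right')

lemma exists_isQuadruple (ω : Flag) : ∃ p q r s, IsQuadruple ω p q r s := by
  obtain ⟨p, q, hp, hq, h⟩ := exists_symProd_eq ω.point.rep_nonzero
  obtain ⟨r, s, hr, hs, h'⟩ := exists_secantForm_eq ω.line.rep_nonzero
  refine ⟨p, q, r, s, hp, hq, hr, hs, ?_, ?_⟩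
  · rw [← ω.point.mk_rep]; congr 1
  · rw [← ω.line.mk_rep]; congr 1

lemma IsQuadruple.harmonic {ω : Flag} {p q r s : Fin 2 → ℂ} (h : IsQuadruple ω p q r s) :
    bracket p r * bracket q s + bracket p s * bracket q r = 0 := by
  have h1 : Incident ω.point ω.line := ω.2
  rw [h.point_eq, h.line_eq, incident_mk] at h1
  rw [← symProd_dotProduct_secantForm, h1, mul_zero]

/-- The binary form with the same roots as the restriction of a linear form to the conic. -/
def dualVec (y : Fin 3 → ℂ) : Fin 3 → ℂ := ![y 2, -2 * y 1, y 0]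

lemma dualVec_smul (k : ℂ) (y : Fin 3 → ℂ) : dualVec (k • y) = k • dualVec y := by
  ext i
  fin_cases i <;> simp [dualVec]
  ring

lemma dualVec_secantForm (u v : Fin 2 → ℂ) : dualVec (secantForm u v) = symProd u v := by
  ext i
  fin_cases i <;> simp [dualVec, secantForm, symProd]
  ring

/-- `Q` is a point of the closed ball of Hermitian forms that lies on the two geodesics of `ω`. -/
def IsCenter (ω : Flag) (Q : ℝ × ℂ × ℝ) : Prop :=
  Psd Q ∧ defect ω.point.rep Q = 0 ∧ defect (dualVec ω.line.rep) Q = 0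

lemma defect_rep_mk {x : Fin 3 → ℂ} (hx : x ≠ 0) (Q : ℝ × ℂ × ℝ) :
    defect (Projectivization.mk ℂ x hx).rep Q = 0 ↔ defect x Q = 0 := by
  obtain ⟨a, ha⟩ := Projectivization.exists_smul_eq_mk_rep ℂ x hx
  rw [← ha, Units.smul_def, defect_smul]
  simp

lemma defect_dualVec_rep_mk {x : Fin 3 → ℂ} (hx : x ≠ 0) (Q : ℝ × ℂ × ℝ) :
    defect (dualVec (Projectivization.mk ℂ x hx).rep) Q = 0 ↔ defect (dualVec x) Q = 0 := by
  obtain ⟨a, ha⟩ := Projectivization.exists_smul_eq_mk_rep ℂ x hx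
  rw [← ha, Units.smul_def, dualVec_smul, defect_smul]
  simp

lemma IsQuadruple.isCenter_iff {ω : Flag} {p q r s : Fin 2 → ℂ} (h : IsQuadruple ω p q r s)
    (Q : ℝ × ℂ × ℝ) : IsCenter ω Q ↔ Psd Q ∧ herm Q p q = 0 ∧ herm Q r s = 0 := by
  unfold IsCenter
  rw [h.point_eq, h.line_eq, defect_rep_mk, defect_dualVec_rep_mk, dualVec_secantForm,
    defect_symProd_eq_zero, defect_symProd_eq_zero]

lemma exists_isCenter (ω : Flag) : ∃ Q, IsCenter ω Q ∧ 0 < Q.1 + Q.2.2 := by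
  obtain ⟨p, q, r, s, h⟩ := exists_isQuadruple ω
  obtain ⟨Q, h1, h2, h3, h4⟩ := exists_psd_herm_eq_zero h.left h.left' h.right' h.harmonic
  exact ⟨Q, (h.isCenter_iff Q).mpr ⟨h1, h3, h4⟩, h2⟩

lemma IsCenter.smul {ω : Flag} {Q : ℝ × ℂ × ℝ} (h : IsCenter ω Q) {t : ℝ} (ht : 0 ≤ t) :
    IsCenter ω (t • Q) := by
  obtain ⟨p, q, r, s, hω⟩ := exists_isQuadruple ω
  rw [hω.isCenter_iff] at *
  obtain ⟨h1, h2, h3⟩ := h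
  exact ⟨h1.smul ht, by rw [herm_smul_real, h2, mul_zero], by rw [herm_smul_real, h3, mul_zero]⟩

lemma IsCenter.eq_smul {ω : Flag} {Q R : ℝ × ℂ × ℝ} (hQ : IsCenter ω Q) (hR : IsCenter ω R)
    (hR0 : 0 < R.1 + R.2.2) : ∃ t : ℝ, Q = t • R := by
  obtain ⟨p, q, r, s, h⟩ := exists_isQuadruple ω
  obtain ⟨Q₀, hQ₀⟩ := exists_forall_eq_smul h.left h.right h.right' h.left' h.harmonic
  rw [h.isCenter_iff] at hQ hR
  obtain ⟨t, rfl⟩ := hQ₀ Q hQ.1 hQ.2.1 hQ.2.2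
  obtain ⟨t', rfl⟩ := hQ₀ R hR.1 hR.2.1 hR.2.2
  refine ⟨t / t', ?_⟩
  rw [smul_smul, div_mul_cancel₀]
  rintro rfl
  simp at hR0

lemma exists_isCenter_trace_one (ω : Flag) : ∃ Q, IsCenter ω Q ∧ Q.1 + Q.2.2 = 1 := by
  obtain ⟨Q, hQ, h⟩ := exists_isCenter ω
  refine ⟨(Q.1 + Q.2.2)⁻¹ • Q, hQ.smul (inv_nonneg.mpr h.le), ?_⟩
  simp only [Prod.smul_fst, Prod.smul_snd, smul_eq_mul]
  rw [← mul_add, inv_mul_cancel₀ h.ne']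

/-- The center of `ω` as a Hermitian form of trace one. -/
def center (ω : Flag) : ℝ × ℂ × ℝ := (exists_isCenter_trace_one ω).choose

lemma isCenter_center (ω : Flag) : IsCenter ω (center ω) :=
  (exists_isCenter_trace_one ω).choose_spec.1

lemma center_trace (ω : Flag) : (center ω).1 + (center ω).2.2 = 1 :=
  (exists_isCenter_trace_one ω).choose_spec.2

lemma IsCenter.eq_center {ω : Flag} {Q : ℝ × ℂ × ℝ} (hQ : IsCenter ω Q) (h : Q.1 + Q.2.2 = 1) :
    Q = center ω := by
  obtain ⟨t, ht⟩ := hQ.eq_smul (isCenter_center ω) (by rw [center_trace]; exact one_pos)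
  have h1 : t * ((center ω).1 + (center ω).2.2) = 1 := by
    rw [← h, ht]; simp only [Prod.smul_fst, Prod.smul_snd, smul_eq_mul]; ring
  rw [center_trace, mul_one] at h1
  rw [ht, h1, one_smul]

/-! ### The projection to the upper half-plane -/

/-- `z` is the projection to the hyperbolic plane of the center of `ω`. -/
def IsProj (ω : Flag) (z : ℍ) : Prop :=
  ∃ Q, IsCenter ω Q ∧ 0 < Q.2.2 ∧ Q.1 = Q.2.2 * Complex.normSq z ∧ Q.2.1.re = Q.2.2 * z.re

lemma upper_ext_normSq {z w : ℍ} (h1 : Complex.normSq z = Complex.normSq w) (h2 : z.re = w.re) :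
    z = w := by
  have h3 : z.im = w.im := by
    have e1 : Complex.normSq z = z.re * z.re + z.im * z.im := Complex.normSq_apply _
    have e2 : Complex.normSq w = w.re * w.re + w.im * w.im := Complex.normSq_apply _
    rw [e1, e2, h2] at h1
    nlinarith [z.im_pos, w.im_pos]
  exact UpperHalfPlane.ext (Complex.ext h2 h3)

lemma IsProj.eq {ω : Flag} {z w : ℍ} (hz : IsProj ω z) (hw : IsProj ω w) : z = w := by
  obtain ⟨Q, hQ, hQ0, hQ1, hQ2⟩ := hz
  obtain ⟨R, hR, hR0, hR1, hR2⟩ := hw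
  obtain ⟨t, rfl⟩ := hQ.eq_smul hR (add_pos_of_nonneg_of_pos hR.1.1 hR0)
  simp only [Prod.smul_fst, Prod.smul_snd, smul_eq_mul, Complex.real_smul, Complex.re_ofReal_mul]
    at hQ0 hQ1 hQ2
  rw [hR1, ← mul_assoc] at hQ1
  rw [hR2, ← mul_assoc] at hQ2
  exact upper_ext_normSq (mul_left_cancel₀ hQ0.ne' hQ1).symm (mul_left_cancel₀ hQ0.ne' hQ2).symm

/-- The point of the upper half-plane that is determined by a positive definite real form. -/
def toUpper (Q : ℝ × ℂ × ℝ) (hQ : Q.2.1.re ^ 2 < Q.1 * Q.2.2) (hc : 0 < Q.2.2) : ℍ :=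
  ⟨⟨Q.2.1.re / Q.2.2, √(Q.1 * Q.2.2 - Q.2.1.re ^ 2) / Q.2.2⟩,
    div_pos (Real.sqrt_pos.mpr (sub_pos.mpr hQ)) hc⟩

lemma isProj_toUpper {ω : Flag} {Q : ℝ × ℂ × ℝ} (h : IsCenter ω Q)
    (hQ : Q.2.1.re ^ 2 < Q.1 * Q.2.2) (hc : 0 < Q.2.2) : IsProj ω (toUpper Q hQ hc) := by
  refine ⟨Q, h, hc, ?_, ?_⟩
  · simp only [toUpper, Complex.normSq_mk]
    rw [← sq, ← sq, div_pow, div_pow, Real.sq_sqrt (sub_pos.mpr hQ).le]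
    field_simp
    ring
  · change _ = _ * (Q.2.1.re / Q.2.2)
    field_simp

/-- The real part of a form lying over z has determinant c² (Im z)², which is positive; passing to
trace one only rescales by a positive factor. -/
lemma IsProj.center_pos {ω : Flag} {z : ℍ} (h : IsProj ω z) :
    (center ω).2.1.re ^ 2 < (center ω).1 * (center ω).2.2 ∧ 0 < (center ω).2.2 := by
  obtain ⟨Q, hQ, hQ0, hQ1, hQ2⟩ := h
  obtain ⟨t, ht⟩ := (isCenter_center ω).eq_smul hQ (add_pos_of_nonneg_of_pos hQ.1.1 hQ0)
  have htr := center_trace ω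
  have hc0 := (isCenter_center ω).1.2.1
  rw [ht] at htr hc0 ⊢
  simp only [Prod.smul_fst, Prod.smul_snd, smul_eq_mul, Complex.real_smul, Complex.re_ofReal_mul]
    at *
  have ht0 : t ≠ 0 := by rintro rfl; simp at htr
  have ht1 : 0 < t := lt_of_le_of_ne (nonneg_of_mul_nonneg_left hc0 hQ0) ht0.symm
  refine ⟨?_, mul_pos ht1 hQ0⟩
  have e1 : Complex.normSq z = z.re * z.re + z.im * z.im := Complex.normSq_apply _
  rw [hQ1, hQ2, e1]
  have : 0 < (t * Q.2.2) ^ 2 * z.im ^ 2 := by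
    have := z.im_pos
    positivity
  nlinarith

/-- The projection of a flag to the upper half-plane, with an irrelevant value for flags whose
center is a boundary point of the hyperbolic plane. -/
def proj (ω : Flag) : ℍ :=
  open Classical in if h : ∃ z, IsProj ω z then h.choose else UpperHalfPlane.I

lemma IsProj.proj_eq {ω : Flag} {z : ℍ} (h : IsProj ω z) : proj ω = z := by
  have h' : ∃ z, IsProj ω z := ⟨z, h⟩
  rw [proj, dif_pos h']
  exact h'.choose_spec.eq h

lemma coe_proj {ω : Flag} {z : ℍ} (h : IsProj ω z) :
    (proj ω : ℂ) = ⟨(center ω).2.1.re / (center ω).2.2,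
      √((center ω).1 * (center ω).2.2 - (center ω).2.1.re ^ 2) / (center ω).2.2⟩ := by
  rw [(isProj_toUpper (isCenter_center ω) h.center_pos.1 h.center_pos.2).proj_eq]
  rfl

/-- One of the two divisors of such a flag is 2t, so t is isotropic for Q and Q is the boundary
point t. -/
lemma isCenter_stdPrincipalCurve {ω : Flag} {t : P1} {Q : ℝ × ℂ × ℝ} (h : IsCenter ω Q)
    (ht : ω ∈ thickening (stdPrincipalCurve t)) : ∃ k : ℝ, Q = k • rankOne t.rep := by
  have e : ∀ u : Fin 2 → ℂ, symProd u u = ![u 0 ^ 2, 2 * (u 0 * u 1), u 1 ^ 2] := by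
    intro u; ext i; fin_cases i <;> simp [symProd] <;> ring
  have e' : ∀ u : Fin 2 → ℂ, dualVec ![u 1 ^ 2, -(u 0 * u 1), u 0 ^ 2] = symProd u u := by
    intro u; ext i; fin_cases i <;> simp [symProd, dualVec] <;> ring
  obtain ⟨h1, h2, h3⟩ := h
  refine h1.eq_smul_rankOne t.rep_nonzero ?_
  rw [← defect_symProd_eq_zero]
  rcases ht with ht | ht
  · rw [ht] at h2
    change defect (Projectivization.mk ℂ _ (square_ne_zero t.rep_nonzero)).rep Q = 0 at h2
    rwa [defect_rep_mk, ← e] at h2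
  · rw [ht] at h3
    change defect (dualVec (Projectivization.mk ℂ _ (tangent_ne_zero t.rep_nonzero)).rep) Q = 0 at h3
    rwa [defect_dualVec_rep_mk, e'] at h3

/-- The flags that are in general position to all real points of the principal curve. -/
def stdDomain : Set Flag := (⋃ t ∈ RP1, thickening (stdPrincipalCurve t))ᶜ

lemma mk_symProd_eq {v p q : Fin 2 → ℂ} (hv : v ≠ 0) (hp : p ≠ 0) (hq : q ≠ 0)
    (h1 : bracket v p = 0) (h2 : bracket v q = 0) :
    Projectivization.mk ℂ _ (symProd_ne_zero hp hq) =
      (stdPrincipalCurve (Projectivization.mk ℂ v hv)).point ∧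
    Projectivization.mk ℂ _ (secantForm_ne_zero hp hq) =
      (stdPrincipalCurve (Projectivization.mk ℂ v hv)).line := by
  obtain ⟨a, ha⟩ := Projectivization.exists_smul_eq_mk_rep ℂ v hv
  obtain ⟨k, rfl⟩ := (bracket_eq_zero_iff hv).mp h1
  obtain ⟨l, rfl⟩ := (bracket_eq_zero_iff hv).mp h2
  have hrep : (Projectivization.mk ℂ v hv).rep = (a : ℂ) • v := by rw [← ha, Units.smul_def]
  have ha0 : (a : ℂ) ≠ 0 := a.ne_zero
  constructor
  · unfold stdPrincipalCurve Flag.point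
    rw [Projectivization.mk_eq_mk_iff']
    refine ⟨k * l / (a : ℂ) ^ 2, ?_⟩
    rw [hrep]
    ext i
    fin_cases i <;> simp [symProd] <;> field_simp
    ring
  · unfold stdPrincipalCurve Flag.line
    rw [Projectivization.mk_eq_mk_iff']
    refine ⟨k * l / (a : ℂ) ^ 2, ?_⟩
    rw [hrep]
    ext i
    fin_cases i <;> simp [secantForm] <;> field_simp
    ring

/-- A flag whose center is a boundary point of hyperbolic space. -/
lemma IsCenter.exists_mem_thickening {ω : Flag} {Q : ℝ × ℂ × ℝ} (hQ : IsCenter ω Q)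
    (hQ0 : 0 < Q.1 + Q.2.2) (hdet : Q.1 * Q.2.2 ≤ Complex.normSq Q.2.1) :
    ∃ (v : Fin 2 → ℂ) (hv : v ≠ 0), (Q.2.1.im = 0 → ∀ i, (v i).im = 0) ∧
      ω ∈ thickening (stdPrincipalCurve (Projectivization.mk ℂ v hv)) := by
  obtain ⟨v, hv, t, ht, hQv, hreal⟩ := hQ.1.exists_eq_rankOne hQ0 hdet
  refine ⟨v, hv, hreal, ?_⟩
  obtain ⟨p, q, r, s, h⟩ := exists_isQuadruple ω
  have ht' : (t : ℂ) ≠ 0 := by exact_mod_cast ht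
  rw [h.isCenter_iff, hQv, herm_smul_real, herm_smul_real] at hQ
  obtain ⟨-, h1, h2⟩ := hQ
  rcases bracket_eq_zero_of_herm_rankOne hv h.left h.left' h.right h.right' h.harmonic
    (by simpa [ht'] using h1) (by simpa [ht'] using h2) with ⟨h3, h4⟩ | ⟨h3, h4⟩
  · left
    rw [h.point_eq, (mk_symProd_eq hv h.left h.left' h3 h4).1]
  · right
    rw [h.line_eq, (mk_symProd_eq hv h.right h.right' h3 h4).2]

/-- The projection fails exactly when the real part of the center is singular, and this happens only
when the center is a real boundary point. -/
lemma mem_stdDomain_iff (ω : Flag) : ω ∈ stdDomain ↔ ∃ z, IsProj ω z := by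
  constructor
  · intro h
    have hc := isCenter_center ω
    have htr := center_trace ω
    have hlt : (center ω).2.1.re ^ 2 < (center ω).1 * (center ω).2.2 := by
      by_contra hle
      push Not at hle
      have h1 := hc.1.2.2
      -- (Re b)² ≥ ac ≥ |b|² leaves no room for an imaginary part and also makes the center
      -- singular.
      have him : (center ω).2.1.im = 0 := by
        rw [Complex.normSq_apply] at h1
        nlinarith
      obtain ⟨v, hv, hreal, hmem⟩ := hc.exists_mem_thickening (by rw [htr]; exact one_pos)
        (by rw [Complex.normSq_apply, him]; nlinarith)
      apply h
      simp only [Set.mem_iUnion]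
      have hv' : (fun i => ((v i).re : ℂ)) = v :=
        funext fun i => Complex.ext (by simp) (by simp [hreal him i])
      exact ⟨_, ⟨fun i => (v i).re, by rwa [hv'], by simp only [hv']⟩, hmem⟩
    have hc0 : 0 < (center ω).2.2 := by
      refine lt_of_le_of_ne hc.1.2.1 fun h0 => ?_
      rw [← h0, mul_zero] at hlt
      nlinarith
    exact ⟨_, isProj_toUpper hc hlt hc0⟩
  · rintro ⟨z, hz⟩ h
    simp only [Set.mem_iUnion] at h
    obtain ⟨t, ⟨v, hv, rfl⟩, ht⟩ := h
    obtain ⟨h1, h2⟩ := hz.center_pos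
    obtain ⟨k, hk⟩ := isCenter_stdPrincipalCurve (isCenter_center ω) ht
    obtain ⟨a, ha⟩ := Projectivization.exists_smul_eq_mk_rep ℂ _ hv
    rw [← ha] at hk
    rw [hk] at h1
    simp [rankOne, Units.smul_def, Complex.normSq_apply] at h1
    nlinarith

/-! ### Equivariance -/

lemma mulVec_ne_zero (A : SL(2, ℂ)) {u : Fin 2 → ℂ} (hu : u ≠ 0) : A.1 *ᵥ u ≠ 0 :=
  (smul_ne_zero_iff_ne A).mpr hu

lemma symSquareMatrix_mulVec_symProd (A : Matrix (Fin 2) (Fin 2) ℂ) (u v : Fin 2 → ℂ) :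
    symSquareMatrix A *ᵥ symProd u v = symProd (A *ᵥ u) (A *ᵥ v) := by
  ext i
  fin_cases i <;>
    simp [symSquareMatrix, symProd, mulVec, dotProduct, Fin.sum_univ_succ] <;> ring

lemma contragredient_mulVec_secantForm (A : SL(2, ℂ)) (u v : Fin 2 → ℂ) :
    (contragredientSL (symSquare A)).1 *ᵥ secantForm u v =
      secantForm (A.1 *ᵥ u) (A.1 *ᵥ v) := by
  have h : (contragredientSL (symSquare A)).1 = (symSquareMatrix (A⁻¹).1)ᵀ := by
    change ((symSquare A)⁻¹.transpose).1 = _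
    rw [← map_inv]
    rfl
  have h' : (A⁻¹).1 = !![A.1 1 1, -A.1 0 1; -A.1 1 0, A.1 0 0] := by
    rw [← Matrix.adjugate_fin_two]
    exact Matrix.SpecialLinearGroup.coe_inv A
  rw [h, h']
  ext i
  fin_cases i <;>
    simp [symSquareMatrix, secantForm, mulVec, dotProduct, Fin.sum_univ_succ] <;> ring

lemma IsQuadruple.smul {ω : Flag} {p q r s : Fin 2 → ℂ} (h : IsQuadruple ω p q r s)
    (A : SL(2, ℂ)) : IsQuadruple (principal (QuotientGroup.mk A) • ω)
      (A.1 *ᵥ p) (A.1 *ᵥ q) (A.1 *ᵥ r) (A.1 *ᵥ s) := by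
  refine ⟨mulVec_ne_zero A h.left, mulVec_ne_zero A h.left', mulVec_ne_zero A h.right,
    mulVec_ne_zero A h.right', ?_, ?_⟩
  · change symSquare A • ω.point = _
    rw [h.point_eq, Projectivization.smul_mk]
    congr 1
    exact symSquareMatrix_mulVec_symProd _ _ _
  · change contragredientSL (symSquare A) • ω.line = _
    rw [h.line_eq, Projectivization.smul_mk]
    congr 1
    exact contragredient_mulVec_secantForm _ _ _

/-- The Hermitian form `A Q Aᵀ`. -/
def congrHerm (A : SL(2, ℝ)) (Q : ℝ × ℂ × ℝ) : ℝ × ℂ × ℝ :=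
  (A.1 0 0 ^ 2 * Q.1 + 2 * (A.1 0 0 * A.1 0 1) * Q.2.1.re + A.1 0 1 ^ 2 * Q.2.2,
    (A.1 0 0 * A.1 1 0 * Q.1 : ℝ) + (A.1 0 0 * A.1 1 1 : ℝ) * Q.2.1 +
      (A.1 0 1 * A.1 1 0 : ℝ) * conj Q.2.1 + (A.1 0 1 * A.1 1 1 * Q.2.2 : ℝ),
    A.1 1 0 ^ 2 * Q.1 + 2 * (A.1 1 0 * A.1 1 1) * Q.2.1.re + A.1 1 1 ^ 2 * Q.2.2)

/-- The inclusion of `SL(2, ℝ)` in `SL(2, ℂ)`. -/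
abbrev toSL2C (A : SL(2, ℝ)) : SL(2, ℂ) := Matrix.SpecialLinearGroup.map (algebraMap ℝ ℂ) A

/-- Brackets scale by det A, so the form scales by (det A)² = 1. -/
lemma herm_congrHerm (A : SL(2, ℝ)) (Q : ℝ × ℂ × ℝ) (u v : Fin 2 → ℂ) :
    herm (congrHerm A Q) ((toSL2C A).1 *ᵥ u) ((toSL2C A).1 *ᵥ v) = herm Q u v := by
  have h := A.2
  rw [Matrix.det_fin_two] at h
  have hC : (A.1 0 0 : ℂ) * A.1 1 1 - A.1 0 1 * A.1 1 0 = 1 := by exact_mod_cast h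
  obtain ⟨a, b, c⟩ := Q
  have hb : (b.re : ℂ) = (b + conj b) / 2 := by rw [Complex.add_conj]; simp
  have e : herm (congrHerm A (a, b, c)) ((toSL2C A).1 *ᵥ u) ((toSL2C A).1 *ᵥ v) =
      ((A.1 0 0 : ℂ) * A.1 1 1 - A.1 0 1 * A.1 1 0) ^ 2 * herm (a, b, c) u v := by
    simp [herm, congrHerm, mulVec, dotProduct, Fin.sum_univ_two, hb]
    ring
  rw [e, hC, one_pow, one_mul]

lemma psd_congrHerm {A : SL(2, ℝ)} {Q : ℝ × ℂ × ℝ} (hQ : Psd Q) : Psd (congrHerm A Q) := by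
  rw [psd_iff_herm] at *
  intro u
  have h := hQ ((toSL2C A)⁻¹ • u)
  rw [← herm_congrHerm A] at h
  have e : (toSL2C A).1 *ᵥ ((toSL2C A)⁻¹ • u) = u := smul_inv_smul (toSL2C A) u
  rwa [e] at h

lemma IsCenter.congr {ω : Flag} {Q : ℝ × ℂ × ℝ} (h : IsCenter ω Q) (A : SL(2, ℝ)) :
    IsCenter (principal (realToComplex (QuotientGroup.mk A)) • ω) (congrHerm A Q) := by
  obtain ⟨p, q, r, s, hω⟩ := exists_isQuadruple ω
  have hω' := hω.smul (toSL2C A)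
  rw [hω.isCenter_iff] at h
  refine (hω'.isCenter_iff _).mpr ⟨psd_congrHerm h.1, ?_, ?_⟩
  · rw [herm_congrHerm, h.2.1]
  · rw [herm_congrHerm, h.2.2]

lemma coe_sl_smul (A : SL(2, ℝ)) (z : ℍ) :
    ((A • z : ℍ) : ℂ) = (A.1 0 0 * z + A.1 0 1) / (A.1 1 0 * z + A.1 1 1) := by
  rw [UpperHalfPlane.specialLinearGroup_apply]
  simp

lemma sl_denom_ne_zero (A : SL(2, ℝ)) (z : ℍ) : (A.1 1 0 : ℂ) * z + A.1 1 1 ≠ 0 := by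
  intro h
  have h1 := congrArg Complex.im h
  have h2 := congrArg Complex.re h
  have h0 := A.2
  rw [Matrix.det_fin_two] at h0
  simp at h1 h2
  replace h1 := h1.resolve_right z.im_ne_zero
  rw [h1] at h2
  simp at h2
  rw [h1, h2] at h0
  simp at h0

/-- Congruence by a real matrix commutes with taking real parts, and on real forms it is the Möbius
action. The factor |A₁₀ z + A₁₁|² in `e1` is the usual automorphy factor. -/
lemma IsProj.smul {ω : Flag} {z : ℍ} (h : IsProj ω z) (A : PSL(2, ℝ)) :
    IsProj (principal (realToComplex A) • ω) (A • z) := by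
  induction A using QuotientGroup.induction_on with
  | H A =>
    change IsProj _ (A • z)
    obtain ⟨⟨a, b, c⟩, hQ, hQ0, hQ1, hQ2⟩ := h
    simp only at hQ0 hQ1 hQ2
    have hd := sl_denom_ne_zero A z
    have hn : 0 < Complex.normSq (A.1 1 0 * z + A.1 1 1) := Complex.normSq_pos.mpr hd
    have e1 : (congrHerm A (a, b, c)).2.2 = c * Complex.normSq (A.1 1 0 * z + A.1 1 1) := by
      simp only [congrHerm, hQ1, hQ2, Complex.normSq_apply]
      simp; ring
    refine ⟨congrHerm A (a, b, c), hQ.congr A, ?_, ?_, ?_⟩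
    · rw [e1]; exact mul_pos hQ0 hn
    · rw [e1, coe_sl_smul, Complex.normSq_div, mul_assoc, mul_div_cancel₀ _ hn.ne']
      simp only [congrHerm, hQ1, hQ2, Complex.normSq_apply]
      simp; ring
    · have e2 : (A • z : ℍ).re * Complex.normSq (A.1 1 0 * z + A.1 1 1) =
          ((A.1 0 0 * (z : ℂ) + A.1 0 1) * conj (A.1 1 0 * (z : ℂ) + A.1 1 1)).re := by
        rw [← UpperHalfPlane.coe_re, coe_sl_smul, ← Complex.re_mul_ofReal,
          Complex.normSq_eq_conj_mul_self]
        congr 1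
        generalize (A.1 1 0 : ℂ) * z + A.1 1 1 = D at hd ⊢
        field_simp
      rw [e1, mul_assoc, mul_comm (Complex.normSq _), e2]
      simp only [congrHerm, hQ1, hQ2, Complex.normSq_apply]
      simp [hQ2]; ring

lemma smul_mem_stdDomain {ω : Flag} (h : ω ∈ stdDomain) (A : PSL(2, ℝ)) :
    principal (realToComplex A) • ω ∈ stdDomain := by
  rw [mem_stdDomain_iff] at *
  obtain ⟨z, hz⟩ := h
  exact ⟨_, hz.smul A⟩

lemma isProj_proj {ω : Flag} (h : ω ∈ stdDomain) : IsProj ω (proj ω) := by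
  obtain ⟨z, hz⟩ := (mem_stdDomain_iff ω).mp h
  rwa [hz.proj_eq]

lemma proj_smul {ω : Flag} (h : ω ∈ stdDomain) (A : PSL(2, ℝ)) :
    proj (principal (realToComplex A) • ω) = A • proj ω :=
  ((isProj_proj h).smul A).proj_eq

/-! ### The open stratum -/

lemma mk_ne_iff_bracket (p q : P1) : p ≠ q ↔ bracket p.rep q.rep ≠ 0 := by
  rw [not_iff_not, bracket_eq_zero_iff p.rep_nonzero]
  constructor
  · rintro rfl
    exact ⟨1, (one_smul _ _).symm⟩
  · rintro ⟨k, hk⟩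
    rw [← p.mk_rep, ← q.mk_rep, eq_comm, Projectivization.mk_eq_mk_iff']
    exact ⟨k, hk.symm⟩

lemma incident_tangent_iff {x : Fin 3 → ℂ} (hx : x ≠ 0) (p : P1) :
    Incident (Projectivization.mk ℂ x hx) (stdPrincipalCurve p).line ↔
      x ⬝ᵥ ![p.rep 1 ^ 2, -(p.rep 0 * p.rep 1), p.rep 0 ^ 2] = 0 :=
  incident_mk _ _

lemma incident_point_iff {y : Fin 3 → ℂ} (hy : y ≠ 0) (p : P1) :
    Incident (stdPrincipalCurve p).point (Projectivization.mk ℂ y hy) ↔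
      ![p.rep 0 ^ 2, 2 * (p.rep 0 * p.rep 1), p.rep 1 ^ 2] ⬝ᵥ y = 0 :=
  incident_mk _ _

/-- Two distinct roots of a binary quadratic form determine its linear factors. -/
lemma factors_of_roots {p q a b : Fin 2 → ℂ} (ha : a ≠ 0) (hb : b ≠ 0) (hab : bracket a b ≠ 0)
    (h1 : bracket p a * bracket q a = 0) (h2 : bracket p b * bracket q b = 0) (hp : p ≠ 0)
    (hq : q ≠ 0) : ∃ k l : ℂ, k ≠ 0 ∧ l ≠ 0 ∧
      ((p = k • a ∧ q = l • b) ∨ (p = k • b ∧ q = l • a)) := by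
  have aux : ∀ {u v : Fin 2 → ℂ}, u ≠ 0 → v ≠ 0 → bracket u v = 0 → ∃ k : ℂ, k ≠ 0 ∧ u = k • v := by
    intro u v hu hv h
    rw [bracket_swap, neg_eq_zero, bracket_eq_zero_iff hv] at h
    obtain ⟨k, rfl⟩ := h
    exact ⟨k, by rintro rfl; simp at hu, rfl⟩
  have aux' : ∀ {u : Fin 2 → ℂ}, u ≠ 0 → bracket u a = 0 → bracket u b = 0 → False := by
    intro u hu h h'
    obtain ⟨k, hk, rfl⟩ := aux hu ha h
    have : k * bracket a b = 0 := by rw [← h']; simp [bracket]; ring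
    simp [hk, hab] at this
  rcases mul_eq_zero.mp h1 with h1 | h1 <;> rcases mul_eq_zero.mp h2 with h2 | h2
  · exact (aux' hp h1 h2).elim
  · obtain ⟨k, hk, e⟩ := aux hp ha h1
    obtain ⟨l, hl, e'⟩ := aux hq hb h2
    exact ⟨k, l, hk, hl, Or.inl ⟨e, e'⟩⟩
  · obtain ⟨l, hl, e'⟩ := aux hq ha h1
    obtain ⟨k, hk, e⟩ := aux hp hb h2
    exact ⟨k, l, hk, hl, Or.inr ⟨e, e'⟩⟩
  · exact (aux' hq h1 h2).elim

lemma symProd_smul_smul (k l : ℂ) (u v : Fin 2 → ℂ) :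
    symProd (k • u) (l • v) = (k * l) • symProd u v := by
  ext i
  fin_cases i <;> simp [symProd] <;> ring

lemma symProd_comm (u v : Fin 2 → ℂ) : symProd u v = symProd v u := by
  ext i
  fin_cases i <;> simp [symProd] <;> ring

lemma secantForm_smul_smul (k l : ℂ) (u v : Fin 2 → ℂ) :
    secantForm (k • u) (l • v) = (k * l) • secantForm u v := by
  ext i
  fin_cases i <;> simp [secantForm] <;> ring

lemma secantForm_comm (u v : Fin 2 → ℂ) : secantForm u v = secantForm v u := by
  ext i
  fin_cases i <;> simp [secantForm] <;> ring

/-- The conditions of `HasDivisors` for the standard principal embedding. -/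
def HasStdDivisors (ω : Flag) (p q r s : P1) : Prop :=
  p ≠ q ∧ r ≠ s ∧
    Incident ω.point (stdPrincipalCurve p).line ∧ Incident ω.point (stdPrincipalCurve q).line ∧
    Incident (stdPrincipalCurve r).point ω.line ∧ Incident (stdPrincipalCurve s).point ω.line

/-- A nonzero binary quadratic form with two distinct known roots is determined up to scale, so the
geometric divisors agree with the algebraic factors. -/
lemma HasStdDivisors.isQuadruple {ω : Flag} {a b c d : P1} (h : HasStdDivisors ω a b c d) :
    IsQuadruple ω a.rep b.rep c.rep d.rep := by
  obtain ⟨h1, h2, h3, h4, h5, h6⟩ := h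
  obtain ⟨p, q, r, s, hω⟩ := exists_isQuadruple ω
  rw [mk_ne_iff_bracket] at h1 h2
  rw [hω.point_eq, incident_tangent_iff, symProd_dotProduct_tangent] at h3 h4
  rw [hω.line_eq, incident_point_iff, square_dotProduct_secantForm] at h5 h6
  refine ⟨a.rep_nonzero, b.rep_nonzero, c.rep_nonzero, d.rep_nonzero, ?_, ?_⟩
  · rw [hω.point_eq, Projectivization.mk_eq_mk_iff']
    obtain ⟨k, l, -, -, ⟨e, e'⟩ | ⟨e, e'⟩⟩ := factors_of_roots a.rep_nonzero b.rep_nonzero h1 h3 h4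
      hω.left hω.left'
    · exact ⟨k * l, by rw [e, e', symProd_smul_smul]⟩
    · exact ⟨k * l, by rw [e, e', symProd_smul_smul, symProd_comm]⟩
  · rw [hω.line_eq, Projectivization.mk_eq_mk_iff']
    obtain ⟨k, l, -, -, ⟨e, e'⟩ | ⟨e, e'⟩⟩ := factors_of_roots c.rep_nonzero d.rep_nonzero h2 h5 h6
      hω.right hω.right'
    · exact ⟨k * l, by rw [e, e', secantForm_smul_smul]⟩
    · exact ⟨k * l, by rw [e, e', secantForm_smul_smul, secantForm_comm]⟩

/-! ### Upper half-space as definite Hermitian forms -/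

/-- The Hermitian form of a point of hyperbolic space. -/
def H3.form (x : H3) : ℝ × ℂ × ℝ := (Complex.normSq x.1.1 + x.1.2 ^ 2, x.1.1, 1)

lemma mem_geodesic_iff (x : H3) (p q : P1) : x ∈ geodesic p q ↔ herm x.form p.rep q.rep = 0 := by
  change _ = _ ↔ _
  have : herm x.form p.rep q.rep =
      (p.rep 1 * x.1.1 - p.rep 0) * star (q.rep 1 * x.1.1 - q.rep 0) +
        p.rep 1 * star (q.rep 1) * (x.1.2 : ℂ) ^ 2 := by
    simp [herm, H3.form, Complex.normSq_eq_conj_mul_self]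
    ring
  rw [this]

lemma psd_form (x : H3) : Psd x.form := by
  refine ⟨?_, zero_le_one, ?_⟩
  · exact add_nonneg (Complex.normSq_nonneg _) (sq_nonneg _)
  · simp [H3.form, sq_nonneg]

/-- The point of hyperbolic space of a positive definite Hermitian form. -/
def toH3 (Q : ℝ × ℂ × ℝ) (hQ : Complex.normSq Q.2.1 < Q.1 * Q.2.2) (hc : 0 < Q.2.2) : H3 :=
  ⟨(Q.2.1 / Q.2.2, √(Q.1 * Q.2.2 - Complex.normSq Q.2.1) / Q.2.2),
    div_pos (Real.sqrt_pos.mpr (sub_pos.mpr hQ)) hc⟩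

lemma form_toH3 {Q : ℝ × ℂ × ℝ} (hQ : Complex.normSq Q.2.1 < Q.1 * Q.2.2) (hc : 0 < Q.2.2) :
    (toH3 Q hQ hc).form = Q.2.2⁻¹ • Q := by
  refine Prod.ext ?_ (Prod.ext ?_ ?_)
  · simp only [toH3, H3.form, Complex.normSq_div, Complex.normSq_ofReal, Prod.smul_fst, smul_eq_mul]
    rw [div_pow, Real.sq_sqrt (sub_pos.mpr hQ).le]
    field_simp
    ring
  · simp [toH3, H3.form, div_eq_inv_mul]
  · simp [H3.form, hc.ne']

/-- At (x + yi, t) the real part of the form is (x² + y² + t², x, 1), which is the form of x + i√(y²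
+ t²). -/
lemma isProj_orthProj {ω : Flag} {x : H3} (h : IsCenter ω x.form) : IsProj ω (orthProj x) := by
  refine ⟨x.form, h, one_pos, ?_, ?_⟩
  · simp only [H3.form, orthProj, Complex.normSq_mk]
    rw [Real.mul_self_sqrt (by positivity), Complex.normSq_apply]
    ring
  · simp only [H3.form, one_mul]
    rfl

lemma H3.form_injective : Function.Injective H3.form := by
  intro x y h
  have h2 : x.1.1 = y.1.1 := congrArg (fun Q => Q.2.1) h
  have h1 : Complex.normSq x.1.1 + x.1.2 ^ 2 = Complex.normSq y.1.1 + y.1.2 ^ 2 :=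
    congrArg (fun Q => Q.1) h
  have hx := x.2
  have hy := y.2
  rw [h2] at h1
  refine Subtype.ext (Prod.ext h2 ?_)
  nlinarith

/-- A boundary center would make one of the two divisors a double point. For reduced divisors the
center is therefore definite, and its uniqueness up to scale gives a single intersection point. -/
lemma HasStdDivisors.exists_inter_eq {ω : Flag} {a b c d : P1} (h : HasStdDivisors ω a b c d) :
    ∃ x : H3, geodesic a b ∩ geodesic c d = {x} ∧ proj ω = orthProj x := by
  have hω := h.isQuadruple
  have hc := isCenter_center ω
  have htr := center_trace ω
  have hdet : Complex.normSq (center ω).2.1 < (center ω).1 * (center ω).2.2 := by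
    by_contra hle
    push Not at hle
    obtain ⟨v, hv, t, ht, hQv, -⟩ := hc.1.exists_eq_rankOne (by rw [htr]; exact one_pos) hle
    have ht' : (t : ℂ) ≠ 0 := by exact_mod_cast ht
    obtain ⟨-, h1, h2⟩ := (hω.isCenter_iff _).mp hc
    rw [hQv, herm_smul_real] at h1 h2
    have hpq := (mk_ne_iff_bracket _ _).mp h.1
    have hrs := (mk_ne_iff_bracket _ _).mp h.2.1
    have aux : ∀ {u w : Fin 2 → ℂ}, bracket v u = 0 → bracket v w = 0 → bracket u w = 0 := by
      intro u w hu hw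
      obtain ⟨k, rfl⟩ := (bracket_eq_zero_iff hv).mp hu
      obtain ⟨l, rfl⟩ := (bracket_eq_zero_iff hv).mp hw
      simp [bracket]; ring
    rcases bracket_eq_zero_of_herm_rankOne hv hω.left hω.left' hω.right hω.right' hω.harmonic
      (by simpa [ht'] using h1) (by simpa [ht'] using h2) with ⟨h3, h4⟩ | ⟨h3, h4⟩
    · exact hpq (aux h3 h4)
    · exact hrs (aux h3 h4)
  have hc0 : 0 < (center ω).2.2 := by
    refine lt_of_le_of_ne hc.1.2.1 fun h0 => ?_
    rw [← h0, mul_zero] at hdet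
    exact (Complex.normSq_nonneg _).not_gt hdet
  have hx : IsCenter ω (toH3 (center ω) hdet hc0).form := by
    rw [form_toH3]
    exact hc.smul (inv_nonneg.mpr hc0.le)
  refine ⟨toH3 (center ω) hdet hc0, ?_, (isProj_orthProj hx).proj_eq⟩
  ext y
  rw [Set.mem_inter_iff, mem_geodesic_iff, mem_geodesic_iff, Set.mem_singleton_iff]
  constructor
  · intro hy
    have hy' : IsCenter ω y.form := (hω.isCenter_iff _).mpr ⟨psd_form y, hy.1, hy.2⟩
    obtain ⟨t, ht⟩ := hy'.eq_smul hx (add_pos_of_nonneg_of_pos (psd_form _).1 one_pos)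
    have ht1 : (1 : ℝ) = t * 1 := congrArg (fun Q => Q.2.2) ht
    rw [mul_one] at ht1
    rw [← ht1, one_smul] at ht
    exact H3.form_injective ht
  · rintro rfl
    exact ((hω.isCenter_iff _).mp hx).2

/-- A point of the conic lies on only one tangent, and a tangent meets the conic only once: the
pairing of the point at t with the tangent at u is [t,u]². -/
lemma HasStdDivisors.notMem_thickening {ω : Flag} {a b c d : P1} (h : HasStdDivisors ω a b c d)
    (t : P1) : ω ∉ thickening (stdPrincipalCurve t) := by
  have key : ∀ u : P1, u ≠ t → bracket t.rep u.rep ≠ 0 := fun u hu =>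
    (mk_ne_iff_bracket _ _).mp hu.symm
  have key1 : ∀ u : P1, Incident (stdPrincipalCurve t).point (stdPrincipalCurve u).line → u = t := by
    intro u hu
    by_contra hne
    have h1 := (incident_point_iff (tangent_ne_zero u.rep_nonzero) t).mp hu
    have h2 : bracket t.rep u.rep ^ 2 = 0 := by
      rw [← h1]
      simp [bracket, dotProduct, Fin.sum_univ_succ]
      ring
    exact key u hne (by simpa using h2)
  have key2 : ∀ u : P1, Incident (stdPrincipalCurve u).point (stdPrincipalCurve t).line → u = t := by
    intro u hu
    by_contra hne
    have h1 := (incident_point_iff (tangent_ne_zero t.rep_nonzero) u).mp hu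
    have h2 : bracket t.rep u.rep ^ 2 = 0 := by
      rw [← h1]
      simp [bracket, dotProduct, Fin.sum_univ_succ]
      ring
    exact key u hne (by simpa using h2)
  obtain ⟨h1, h2, h3, h4, h5, h6⟩ := h
  rintro (ht | ht)
  · rw [ht] at h3 h4
    exact h1 ((key1 a h3).trans (key1 b h4).symm)
  · rw [ht] at h5 h6
    exact h2 ((key2 c h5).trans (key2 d h6).symm)

/-! ### Topology of the flag variety -/

/-- Saturations are unions of scalar translates. Openness matters because products of open quotient
maps are again quotient maps, so closedness and continuity on products can be checked on vectors. -/
lemma isOpenQuotientMap_projectivization_mk' (n : ℕ) :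
    IsOpenQuotientMap (Projectivization.mk' ℂ : {v : Fin n → ℂ // v ≠ 0} → ℙ ℂ (Fin n → ℂ)) := by
  refine (isOpenQuotientMap_iff _).mpr ⟨?_, ?_, ?_⟩
  · exact Quotient.mk_surjective
  · exact continuous_quotient_mk'
  · intro U hU
    have : (Projectivization.mk' ℂ : {v : Fin n → ℂ // v ≠ 0} → ℙ ℂ (Fin n → ℂ)) ⁻¹'
        (Projectivization.mk' ℂ '' U) =
        ⋃ a : ℂˣ, (fun v : {v : Fin n → ℂ // v ≠ 0} =>
          (⟨a • v.1, (smul_ne_zero_iff_ne a).mpr v.2⟩ : {v : Fin n → ℂ // v ≠ 0})) ⁻¹' U := by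
      ext v
      simp only [Set.mem_preimage, Set.mem_image, Set.mem_iUnion]
      constructor
      · rintro ⟨w, hw, h⟩
        obtain ⟨a, ha⟩ := (Projectivization.mk_eq_mk_iff ℂ w.1 v.1 w.2 v.2).mp h
        refine ⟨a, ?_⟩
        convert hw
      · rintro ⟨a, ha⟩
        exact ⟨_, ha, (Projectivization.mk_eq_mk_iff ℂ _ _ _ v.2).mpr ⟨a, rfl⟩⟩
    refine isOpen_coinduced.mpr ?_
    change IsOpen ((Projectivization.mk' ℂ : {v : Fin n → ℂ // v ≠ 0} → ℙ ℂ (Fin n → ℂ)) ⁻¹' _)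
    rw [this]
    refine isOpen_iUnion fun a => hU.preimage ?_
    exact (continuous_subtype_val.const_smul a).subtype_mk _

instance compactSpace_projectivization (n : ℕ) : CompactSpace (ℙ ℂ (Fin n → ℂ)) := by
  have hne : ∀ v : Metric.sphere (0 : Fin n → ℂ) 1, (v : Fin n → ℂ) ≠ 0 := fun v =>
    ne_zero_of_mem_unit_sphere v
  have hcont : Continuous fun v : Metric.sphere (0 : Fin n → ℂ) 1 =>
      Projectivization.mk' ℂ (⟨v, hne v⟩ : {v : Fin n → ℂ // v ≠ 0}) :=
    (isOpenQuotientMap_projectivization_mk' n).continuous.comp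
      (continuous_subtype_val.subtype_mk _)
  have hsurj : Function.Surjective fun v : Metric.sphere (0 : Fin n → ℂ) 1 =>
      Projectivization.mk' ℂ (⟨v, hne v⟩ : {v : Fin n → ℂ // v ≠ 0}) := by
    intro x
    induction x using Projectivization.ind with
    | h v hv =>
      have hn : (‖v‖ : ℂ) ≠ 0 := by exact_mod_cast (norm_ne_zero_iff.mpr hv)
      refine ⟨⟨(‖v‖ : ℂ)⁻¹ • v, ?_⟩, ?_⟩
      · simp [norm_smul, norm_ne_zero_iff.mpr hv]
      · exact (Projectivization.mk_eq_mk_iff' ℂ _ _ _ hv).mpr ⟨(‖v‖ : ℂ)⁻¹, rfl⟩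
  have : CompactSpace (Metric.sphere (0 : Fin n → ℂ) 1) :=
    isCompact_iff_compactSpace.mp (isCompact_sphere _ _)
  exact ⟨by rw [← hsurj.range_eq]; exact isCompact_range hcont⟩

lemma isClosed_incident : IsClosed {x : ℙ ℂ (Fin 3 → ℂ) × ℙ ℂ (Fin 3 → ℂ) | Incident x.1 x.2} := by
  have hq := (isOpenQuotientMap_projectivization_mk' 3).prodMap
    (isOpenQuotientMap_projectivization_mk' 3)
  rw [← hq.isQuotientMap.isClosed_preimage]
  have : Prod.map (Projectivization.mk' ℂ) (Projectivization.mk' ℂ) ⁻¹'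
      {x : ℙ ℂ (Fin 3 → ℂ) × ℙ ℂ (Fin 3 → ℂ) | Incident x.1 x.2} =
      {x : {v : Fin 3 → ℂ // v ≠ 0} × {v : Fin 3 → ℂ // v ≠ 0} | x.1.1 ⬝ᵥ x.2.1 = 0} := by
    ext x
    exact incident_mk x.1.2 x.2.2
  rw [this]
  refine isClosed_eq ?_ continuous_const
  exact (continuous_subtype_val.comp continuous_fst).dotProduct
    (continuous_subtype_val.comp continuous_snd)

instance compactSpace_flag : CompactSpace Flag :=
  isCompact_iff_compactSpace.mp isClosed_incident.isCompact

lemma Flag.continuous_point : Continuous Flag.point :=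
  continuous_fst.comp continuous_subtype_val

lemma Flag.continuous_line : Continuous Flag.line :=
  continuous_snd.comp continuous_subtype_val

lemma continuous_defect_comp {X : Type*} [TopologicalSpace X] {f : X → Fin 3 → ℂ}
    {h : X → ℝ × ℂ × ℝ} (hf : Continuous f) (hh : Continuous h) :
    Continuous fun x => defect (f x) (h x) :=
  Continuous.comp (f := fun x => (f x, h x)) continuous_defect (hf.prodMk hh)

lemma isClosed_defect_point :
    IsClosed {x : ℙ ℂ (Fin 3 → ℂ) × (ℝ × ℂ × ℝ) | defect x.1.rep x.2 = 0} := by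
  have hq := (isOpenQuotientMap_projectivization_mk' 3).prodMap
    (IsOpenQuotientMap.id (X := ℝ × ℂ × ℝ))
  rw [← hq.isQuotientMap.isClosed_preimage]
  have : Prod.map (Projectivization.mk' ℂ) id ⁻¹'
      {x : ℙ ℂ (Fin 3 → ℂ) × (ℝ × ℂ × ℝ) | defect x.1.rep x.2 = 0} =
      {x : {v : Fin 3 → ℂ // v ≠ 0} × (ℝ × ℂ × ℝ) | defect x.1.1 x.2 = 0} := by
    ext x
    exact defect_rep_mk x.1.2 x.2
  rw [this]
  have hc : Continuous fun x : {v : Fin 3 → ℂ // v ≠ 0} × (ℝ × ℂ × ℝ) => defect x.1.1 x.2 :=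
    continuous_defect_comp (continuous_subtype_val.comp continuous_fst) continuous_snd
  exact isClosed_singleton.preimage hc

lemma isClosed_defect_line :
    IsClosed {x : ℙ ℂ (Fin 3 → ℂ) × (ℝ × ℂ × ℝ) | defect (dualVec x.1.rep) x.2 = 0} := by
  have hq := (isOpenQuotientMap_projectivization_mk' 3).prodMap
    (IsOpenQuotientMap.id (X := ℝ × ℂ × ℝ))
  rw [← hq.isQuotientMap.isClosed_preimage]
  have : Prod.map (Projectivization.mk' ℂ) id ⁻¹'
      {x : ℙ ℂ (Fin 3 → ℂ) × (ℝ × ℂ × ℝ) | defect (dualVec x.1.rep) x.2 = 0} =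
      {x : {v : Fin 3 → ℂ // v ≠ 0} × (ℝ × ℂ × ℝ) | defect (dualVec x.1.1) x.2 = 0} := by
    ext x
    exact defect_dualVec_rep_mk x.1.2 x.2
  rw [this]
  have hd : Continuous dualVec := by
    refine continuous_pi fun i => ?_
    fin_cases i <;> simp [dualVec] <;> fun_prop
  have hc : Continuous fun x : {v : Fin 3 → ℂ // v ≠ 0} × (ℝ × ℂ × ℝ) =>
      defect (dualVec x.1.1) x.2 :=
    continuous_defect_comp (hd.comp (continuous_subtype_val.comp continuous_fst)) continuous_snd
  exact isClosed_singleton.preimage hc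

/-! ### Continuity of the center and properness of the projection -/

/-- Hermitian forms of trace one: the closed ball model of hyperbolic space. -/
def closedBall : Set (ℝ × ℂ × ℝ) := {Q | Psd Q ∧ Q.1 + Q.2.2 = 1}

lemma isCompact_closedBall : IsCompact closedBall := by
  refine Metric.isCompact_of_isClosed_isBounded ?_ ?_
  · have : closedBall = {Q | 0 ≤ Q.1} ∩ ({Q | 0 ≤ Q.2.2} ∩
        ({Q | Complex.normSq Q.2.1 ≤ Q.1 * Q.2.2} ∩ {Q | Q.1 + Q.2.2 = 1})) := by
      ext Q
      simp only [closedBall, Psd, Set.mem_ofPred_eq, Set.mem_inter_iff, and_assoc]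
    rw [this]
    have := Complex.continuous_normSq
    refine (isClosed_le ?_ ?_).inter ((isClosed_le ?_ ?_).inter
      ((isClosed_le ?_ ?_).inter (isClosed_eq ?_ ?_))) <;> fun_prop
  · refine (Metric.isBounded_closedBall (x := (0 : ℝ × ℂ × ℝ)) (r := 1)).subset ?_
    rintro ⟨a, b, c⟩ ⟨⟨h1, h2, h3⟩, h4⟩
    simp only at h1 h2 h3 h4
    rw [mem_closedBall_zero_iff, Prod.norm_def, Prod.norm_def]
    refine max_le ?_ (max_le ?_ ?_)
    · rw [Real.norm_of_nonneg h1]; linarith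
    · rw [Complex.normSq_eq_norm_sq] at h3
      simp only
      nlinarith [norm_nonneg b]
    · rw [Real.norm_of_nonneg h2]; linarith

/-- Closed graph theorem: projecting along a compact factor is a closed map, so preimages of closed
sets are closed. -/
lemma continuous_of_isClosed_rel {X Y : Type*} [TopologicalSpace X] [TopologicalSpace Y]
    {K : Set Y} (hK : IsCompact K) {R : Set (X × Y)} (hR : IsClosed R) {f : X → Y}
    (hf : ∀ x y, y ∈ K → ((x, y) ∈ R ↔ y = f x)) (hfK : ∀ x, f x ∈ K) : Continuous f := by
  have : CompactSpace K := isCompact_iff_compactSpace.mp hK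
  rw [continuous_iff_isClosed]
  intro C hC
  have h : f ⁻¹' C = Prod.fst '' {x : X × K | (x.1, x.2.1) ∈ R ∧ x.2.1 ∈ C} := by
    ext x
    simp only [Set.mem_preimage, Set.mem_image, Set.mem_ofPred_eq]
    constructor
    · intro hx
      exact ⟨(x, ⟨f x, hfK x⟩), ⟨(hf _ _ (hfK x)).mpr rfl, hx⟩, rfl⟩
    · rintro ⟨⟨x', y⟩, ⟨h1, h2⟩, rfl⟩
      rw [hf _ _ y.2] at h1
      rwa [← h1]
  rw [h]
  refine isClosedMap_fst_of_compactSpace _ ((hR.preimage ?_).inter (hC.preimage ?_)) <;> fun_prop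

lemma continuous_center : Continuous center := by
  refine continuous_of_isClosed_rel isCompact_closedBall
    (R := {x | defect x.1.point.rep x.2 = 0} ∩ {x | defect (dualVec x.1.line.rep) x.2 = 0})
    ?_ ?_ ?_
  · exact (isClosed_defect_point.preimage (Flag.continuous_point.prodMap continuous_id)).inter
      (isClosed_defect_line.preimage (Flag.continuous_line.prodMap continuous_id))
  · intro ω Q hQ
    constructor
    · intro h
      exact IsCenter.eq_center ⟨hQ.1, h.1, h.2⟩ hQ.2
    · rintro rfl
      exact (isCenter_center ω).2
  · intro ω
    exact ⟨(isCenter_center ω).1, center_trace ω⟩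

lemma continuousOn_proj : ContinuousOn proj stdDomain := by
  rw [continuousOn_iff_continuous_domRestrict, isEmbedding_coe.continuous_iff]
  have h : UpperHalfPlane.coe ∘ stdDomain.domRestrict proj = fun ω : stdDomain =>
      (((center ω.1).2.1.re / (center ω.1).2.2 : ℝ) : ℂ) +
      ((√((center ω.1).1 * (center ω.1).2.2 - (center ω.1).2.1.re ^ 2) /
        (center ω.1).2.2 : ℝ) : ℂ) * Complex.I := by
    ext ω
    have := coe_proj (isProj_proj ω.2)
    change (proj ω.1 : ℂ) = _
    rw [this]
    exact Complex.mk_eq_add_mul_I _ _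
  rw [h]
  have hc : Continuous fun ω : stdDomain => center ω.1 :=
    continuous_center.comp continuous_subtype_val
  have hne : ∀ ω : stdDomain, (center ω.1).2.2 ≠ 0 := fun ω => (isProj_proj ω.2).center_pos.2.ne'
  have h1 : Continuous fun ω : stdDomain => (center ω.1).1 := hc.fst
  have h2 : Continuous fun ω : stdDomain => (center ω.1).2.1 := hc.snd.fst
  have h3 : Continuous fun ω : stdDomain => (center ω.1).2.2 := hc.snd.snd
  refine Continuous.add (Complex.continuous_ofReal.comp ?_)
    (Continuous.mul (Complex.continuous_ofReal.comp ?_) continuous_const)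
  · exact (Complex.continuous_re.comp h2).div h3 hne
  · exact ((h1.mul h3).sub ((Complex.continuous_re.comp h2).pow 2)).sqrt.div h3 hne

/-- The real part of a Hermitian form. -/
def rePart (Q : ℝ × ℂ × ℝ) : ℝ × ℝ × ℝ := (Q.1, Q.2.1.re, Q.2.2)

/-- The real quadratic form of trace one of a point of the upper half-plane. -/
def upperForm (z : ℍ) : ℝ × ℝ × ℝ :=
  (Complex.normSq z / (Complex.normSq z + 1), z.re / (Complex.normSq z + 1),
    1 / (Complex.normSq z + 1))

lemma rePart_center_eq_iff (ω : Flag) (z : ℍ) : rePart (center ω) = upperForm z ↔ IsProj ω z := by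
  have hpos : 0 < Complex.normSq z + 1 := by linarith [Complex.normSq_nonneg (z : ℂ)]
  constructor
  · intro h
    have h1 : (center ω).1 = Complex.normSq z / (Complex.normSq z + 1) := congrArg (·.1) h
    have h2 : (center ω).2.1.re = z.re / (Complex.normSq z + 1) := congrArg (·.2.1) h
    have h3 : (center ω).2.2 = 1 / (Complex.normSq z + 1) := congrArg (·.2.2) h
    refine ⟨center ω, isCenter_center ω, ?_, ?_, ?_⟩
    · rw [h3]; positivity
    · rw [h1, h3]; ring
    · rw [h2, h3]; ring
  · rintro ⟨Q, hQ, hQ0, hQ1, hQ2⟩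
    obtain ⟨t, ht⟩ := (isCenter_center ω).eq_smul hQ (add_pos_of_nonneg_of_pos hQ.1.1 hQ0)
    have htr := center_trace ω
    rw [ht] at htr ⊢
    simp only [Prod.smul_fst, Prod.smul_snd, smul_eq_mul, hQ1] at htr
    have h3 : t * Q.2.2 = 1 / (Complex.normSq z + 1) := by
      rw [eq_div_iff hpos.ne']; linear_combination htr
    refine Prod.ext ?_ (Prod.ext ?_ ?_)
    · simp only [rePart, upperForm, Prod.smul_fst, smul_eq_mul, hQ1]
      rw [← mul_assoc, h3]; ring
    · simp only [rePart, upperForm, Prod.smul_fst, Prod.smul_snd, Complex.real_smul,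
        Complex.re_ofReal_mul, hQ2]
      rw [← mul_assoc, h3]; ring
    · simpa only [rePart, upperForm, Prod.smul_snd, smul_eq_mul] using h3

lemma continuous_upperForm : Continuous upperForm := by
  have h : Continuous fun z : ℍ => Complex.normSq z :=
    Complex.continuous_normSq.comp UpperHalfPlane.continuous_coe
  have hne : ∀ z : ℍ, Complex.normSq z + 1 ≠ 0 := fun z => by
    have := Complex.normSq_nonneg (z : ℂ)
    positivity
  exact (h.div (h.add continuous_const) hne).prodMk
    ((UpperHalfPlane.continuous_re.div (h.add continuous_const) hne).prodMk
      (continuous_const.div (h.add continuous_const) hne))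

/-- The flag variety is compact, so it is enough that preimages of compact sets are closed there and
not merely in the domain. -/
lemma isProperMap_proj : IsProperMap (stdDomain.domRestrict proj) := by
  rw [isProperMap_iff_isCompact_preimage]
  refine ⟨continuousOn_iff_continuous_domRestrict.mp continuousOn_proj, fun {C} hC => ?_⟩
  rw [Subtype.isCompact_iff]
  have hre : Continuous rePart := by unfold rePart; fun_prop
  -- Off the domain the real part of the center is never a value of `upperForm`, so the right-hand
  -- side needs no intersection with the domain.
  have h : Subtype.val '' (stdDomain.domRestrict proj ⁻¹' C) =
      (fun ω => rePart (center ω)) ⁻¹' (upperForm '' C) := by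
    ext ω
    simp only [Set.mem_image, Set.mem_preimage]
    constructor
    · rintro ⟨ω, hω, rfl⟩
      exact ⟨_, hω, ((rePart_center_eq_iff _ _).mpr (isProj_proj ω.2)).symm⟩
    · rintro ⟨z, hz, h⟩
      have hp := (rePart_center_eq_iff _ _).mp h.symm
      refine ⟨⟨ω, (mem_stdDomain_iff ω).mpr ⟨z, hp⟩⟩, ?_, rfl⟩
      change proj ω ∈ C
      rwa [hp.proj_eq]
  rw [h]
  exact ((hC.image continuous_upperForm).isClosed.preimage
    (hre.comp continuous_center)).isCompact

/-! ### Continuity of the actions -/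

lemma continuous_sl_smul (n : ℕ) :
    Continuous fun y : SL(n, ℂ) × ℙ ℂ (Fin n → ℂ) => y.1 • y.2 := by
  have hq := (IsOpenQuotientMap.id (X := SL(n, ℂ))).prodMap
    (isOpenQuotientMap_projectivization_mk' n)
  rw [hq.isQuotientMap.continuous_iff]
  have : Continuous fun y : SL(n, ℂ) × {v : Fin n → ℂ // v ≠ 0} =>
      (⟨y.1.1 *ᵥ y.2.1, (smul_ne_zero_iff_ne y.1).mpr y.2.2⟩ : {v : Fin n → ℂ // v ≠ 0}) := by
    refine Continuous.subtype_mk ?_ _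
    exact (continuous_subtype_val.comp continuous_fst).matrix_mulVec
      (continuous_subtype_val.comp continuous_snd)
  exact (isOpenQuotientMap_projectivization_mk' n).continuous.comp this

lemma continuous_sl_smul_comp {X : Type*} [TopologicalSpace X] {n : ℕ} {f : X → SL(n, ℂ)}
    {h : X → ℙ ℂ (Fin n → ℂ)} (hf : Continuous f) (hh : Continuous h) :
    Continuous fun x => f x • h x :=
  Continuous.comp (f := fun x => (f x, h x)) (continuous_sl_smul n) (hf.prodMk hh)

lemma continuous_symSquare : Continuous symSquare := by
  refine Continuous.subtype_mk ?_ _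
  refine continuous_matrix fun i j => ?_
  have h : ∀ i j, Continuous fun A : SL(2, ℂ) => A.1 i j := fun i j =>
    (continuous_apply_apply i j).comp continuous_subtype_val
  fin_cases i <;> fin_cases j <;> simp only [symSquareMatrix] <;> simp <;> fun_prop

lemma continuous_contragredientSL : Continuous contragredientSL := by
  have h1 : Continuous fun A : SL(3, ℂ) => (A⁻¹).1 := continuous_subtype_val.comp continuous_inv
  exact Continuous.subtype_mk h1.matrix_transpose _

lemma continuous_toSL2C : Continuous toSL2C := by
  refine Continuous.subtype_mk ?_ _
  refine continuous_matrix fun i j => ?_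
  exact Complex.continuous_ofReal.comp ((continuous_apply_apply i j).comp continuous_subtype_val)

lemma continuous_real_smul_flag :
    Continuous fun y : PSL(2, ℝ) × Flag => principal (realToComplex y.1) • y.2 := by
  have hq := (QuotientGroup.isOpenQuotientMap_mk (N := Subgroup.center SL(2, ℝ))).prodMap
    (IsOpenQuotientMap.id (X := Flag))
  rw [hq.isQuotientMap.continuous_iff]
  have h1 : Continuous fun y : SL(2, ℝ) × Flag => symSquare (toSL2C y.1) :=
    continuous_symSquare.comp (continuous_toSL2C.comp continuous_fst)
  have h2 : Continuous fun y : SL(2, ℝ) × Flag => symSquare (toSL2C y.1) • y.2.point :=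
    continuous_sl_smul_comp h1 (Flag.continuous_point.comp continuous_snd)
  have h3 : Continuous fun y : SL(2, ℝ) × Flag =>
      contragredientSL (symSquare (toSL2C y.1)) • y.2.line :=
    continuous_sl_smul_comp (continuous_contragredientSL.comp h1)
      (Flag.continuous_line.comp continuous_snd)
  exact Continuous.subtype_mk (h2.prodMk h3) _

lemma continuous_smul_flag (g : PSL(3, ℂ)) : Continuous fun ω : Flag => g • ω := by
  induction g using QuotientGroup.induction_on with
  | H A =>
    refine Continuous.subtype_mk (Continuous.prodMk ?_ ?_) _
    · exact (continuous_sl_smul 3).comp (continuous_const.prodMk Flag.continuous_point)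
    · exact (continuous_sl_smul 3).comp
        ((continuous_const (y := contragredientSL A)).prodMk Flag.continuous_line)

/-! ### The limit set of a cocompact group -/

lemma psl_isometry (A : PSL(2, ℝ)) (z w : ℍ) : dist (A • z) (A • w) = dist z w := by
  induction A using QuotientGroup.induction_on with
  | H A => exact dist_smul A z w

/-- The images in S of the balls of integer radius about i form an increasing open cover, so by
compactness one ball already meets every orbit. -/
lemma IsUniformization.exists_dist_le {S Γ : Type*} [TopologicalSpace S] [CompactSpace S] [Group Γ]
    {η : Γ →* PSL(2, ℝ)} {p : ℍ → S} (hp : IsUniformization η p) :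
    ∃ D : ℝ, ∀ z : ℍ, ∃ γ, dist (η γ • UpperHalfPlane.I) z ≤ D := by
  obtain ⟨hcov, hsurj, horb⟩ := hp
  have hopen : ∀ n : ℕ, IsOpen (p '' Metric.ball UpperHalfPlane.I n) := fun n =>
    hcov.isLocalHomeomorph.isOpenMap _ Metric.isOpen_ball
  have hmono : Monotone fun n : ℕ => p '' Metric.ball UpperHalfPlane.I n := fun m n hmn =>
    Set.image_mono (Metric.ball_subset_ball (by exact_mod_cast hmn))
  obtain ⟨N, hN⟩ := isCompact_univ.elim_directed_cover _ hopen (by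
    intro s _
    obtain ⟨z, rfl⟩ := hsurj s
    obtain ⟨n, hn⟩ := exists_nat_gt (dist z UpperHalfPlane.I)
    exact Set.mem_iUnion.mpr ⟨n, z, hn, rfl⟩) hmono.directed_le
  refine ⟨N, fun z => ?_⟩
  obtain ⟨w, hw, hwz⟩ := hN (Set.mem_univ (p z))
  obtain ⟨γ, rfl⟩ := (horb w z).mp hwz
  refine ⟨γ, ?_⟩
  rw [psl_isometry, dist_comm]
  exact (Metric.mem_ball.mp hw).le

lemma continuous_mk_of_continuous {X : Type*} [TopologicalSpace X] {f : X → Fin 2 → ℂ}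
    (hf : Continuous f) (hne : ∀ x, f x ≠ 0) :
    Continuous fun x => (Projectivization.mk ℂ (f x) (hne x) : P1) :=
  (isOpenQuotientMap_projectivization_mk' 2).continuous.comp (hf.subtype_mk hne)

lemma IsUniformization.real_mem_closure {S Γ : Type*} [TopologicalSpace S] [CompactSpace S]
    [Group Γ] {η : Γ →* PSL(2, ℝ)} {p : ℍ → S} (hp : IsUniformization η p) (a : ℝ) :
    (a : ℂ) ∈ closure (Set.range fun γ : Γ => ((η γ • UpperHalfPlane.I : ℍ) : ℂ)) := by
  obtain ⟨D, hD⟩ := hp.exists_dist_le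
  rw [Metric.mem_closure_range_iff]
  intro ε hε
  -- At height y over a, hyperbolic distance at most D means Euclidean distance at most y(e^D − 1).
  -- Adding y to reach a gives y e^D, which is ε/2 for this height.
  have hδ : 0 < ε / (2 * Real.exp D) := by positivity
  obtain ⟨γ, hγ⟩ := hD ⟨⟨a, ε / (2 * Real.exp D)⟩, hδ⟩
  refine ⟨γ, ?_⟩
  have h1 := UpperHalfPlane.dist_coe_le (η γ • UpperHalfPlane.I) ⟨⟨a, ε / (2 * Real.exp D)⟩, hδ⟩
  set z : ℍ := ⟨⟨a, ε / (2 * Real.exp D)⟩, hδ⟩ with hz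
  have him : z.im = ε / (2 * Real.exp D) := rfl
  have h2 : dist (a : ℂ) z = z.im := by
    rw [Complex.dist_of_re_eq]
    · change dist 0 z.im = z.im
      rw [Real.dist_eq, zero_sub, abs_neg, abs_of_pos z.im_pos]
    · rfl
  have h3 := Real.exp_le_exp.mpr hγ
  have h4 := dist_triangle (a : ℂ) z ((η γ • UpperHalfPlane.I : ℍ) : ℂ)
  rw [dist_comm (z : ℂ), h2] at h4
  have h5 : z.im * Real.exp D = ε / 2 := by
    rw [him]; field_simp
  nlinarith [z.im_pos]

/-- The point `[w : 1]` of the projective line. -/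
def affinePoint (w : ℂ) : P1 :=
  Projectivization.mk ℂ ![w, 1] (fun h => one_ne_zero (congrFun h 1))

/-- The point `[1 : w]` of the projective line. -/
def affinePoint' (w : ℂ) : P1 :=
  Projectivization.mk ℂ ![1, w] (fun h => one_ne_zero (congrFun h 0))

lemma continuous_affinePoint : Continuous affinePoint := by
  refine continuous_mk_of_continuous (f := fun w : ℂ => ![w, 1]) (continuous_pi fun i => ?_) _
  fin_cases i
  · exact continuous_id
  · exact continuous_const

lemma continuous_affinePoint' : Continuous affinePoint' := by
  refine continuous_mk_of_continuous (f := fun w : ℂ => ![1, w]) (continuous_pi fun i => ?_) _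
  fin_cases i
  · exact continuous_const
  · exact continuous_id

/-- A coarsely dense orbit accumulates at every real number. The point at infinity follows because
the closure is closed. -/
lemma IsUniformization.limitSet_eq {S Γ : Type*} [TopologicalSpace S] [CompactSpace S] [Group Γ]
    {η : Γ →* PSL(2, ℝ)} {p : ℍ → S} (hp : IsUniformization η p) : limitSet η = RP1 := by
  refine Set.Subset.antisymm (fun t ht => ht.1) fun t ht => ⟨ht, UpperHalfPlane.I, ?_⟩
  set C := closure (Set.range fun γ : Γ => upperToP1 (η γ • UpperHalfPlane.I))
  have hfin : ∀ a : ℝ, affinePoint a ∈ C := by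
    intro a
    refine map_mem_closure continuous_affinePoint (hp.real_mem_closure a) ?_
    rintro _ ⟨γ, rfl⟩
    exact ⟨γ, rfl⟩
  obtain ⟨v, hv, rfl⟩ := ht
  by_cases h1 : v 1 = 0
  -- In the other chart infinity is [1 : 0], the limit of [1 : s] = [1/s : 1] as s tends to 0
  -- through nonzero reals.
  · have hmem : affinePoint' ((0 : ℝ) : ℂ) ∈ closure C := by
      refine map_mem_closure (f := fun x : ℝ => affinePoint' (x : ℂ))
        (continuous_affinePoint'.comp Complex.continuous_ofReal) (dense_compl_singleton (0 : ℝ) 0) ?_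
      intro s hs
      have hs' : (s : ℂ) ≠ 0 := by exact_mod_cast hs
      convert hfin s⁻¹ using 1
      refine (Projectivization.mk_eq_mk_iff' ℂ _ _ _ _).mpr ⟨s, ?_⟩
      ext i
      fin_cases i <;> simp [hs']
    rw [isClosed_closure.closure_eq] at hmem
    convert hmem using 1
    refine (Projectivization.mk_eq_mk_iff' ℂ _ _ _ _).mpr ⟨v 0, ?_⟩
    ext i
    fin_cases i <;> simp [h1]
  · convert hfin (v 0 / v 1) using 1
    refine (Projectivization.mk_eq_mk_iff' ℂ _ _ _ _).mpr ⟨v 1, ?_⟩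
    have h1' : (v 1 : ℂ) ≠ 0 := by exact_mod_cast h1
    ext i
    fin_cases i
    · simp; field_simp
    · simp

/-! ### Equivariant bundles over the hyperbolic plane -/

/-- The element of `PSL(2, ℝ)` with upper triangular representative that takes `i` to `z`. -/
def upperSection (z : ℍ) : PSL(2, ℝ) := QuotientGroup.mk z.toSL2R

lemma continuous_upperSection : Continuous upperSection :=
  continuous_quotient_mk'.comp UpperHalfPlane.continuous_toSL2R

lemma upperSection_smul_I (z : ℍ) : upperSection z • UpperHalfPlane.I = z :=
  z.toSL2R_smul_I

lemma upperSection_inv_smul (z : ℍ) : (upperSection z)⁻¹ • z = UpperHalfPlane.I := by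
  rw [inv_smul_eq_iff, upperSection_smul_I]

lemma isFiberBundle_of_homeomorph {F B Z : Type*} [TopologicalSpace F] [TopologicalSpace B]
    [TopologicalSpace Z] {π : Z → B} (e : Z ≃ₜ B × F) (he : ∀ z, (e z).1 = π z) :
    IsFiberBundle F π := fun _ =>
  ⟨{ toOpenPartialHomeomorph := e.toOpenPartialHomeomorph
     baseSet := Set.univ
     open_baseSet := isOpen_univ
     source_eq := by simp
     target_eq := by simp
     proj_toFun := fun z _ => he z }, Set.mem_univ _⟩

instance faithfulSMul_psl : FaithfulSMul PSL(2, ℝ) ℍ where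
  eq_of_smul_eq_smul {A B} h := by
    apply Matrix.ProjectiveSpecialLinearGroup.toPGL_injective
    exact FaithfulSMul.eq_of_smul_eq_smul (α := ℍ) h

/-- The translation and the identity are both lifts of p through the covering p. If they agree at
one point they agree everywhere, and the action is faithful. -/
lemma IsUniformization.eq_one_of_smul_eq {S Γ : Type*} [TopologicalSpace S] [Group Γ]
    {η : Γ →* PSL(2, ℝ)} {p : ℍ → S} (hp : IsUniformization η p) {γ : Γ} {z : ℍ}
    (h : η γ • z = z) : η γ = 1 := by
  have hcont : Continuous fun w : ℍ => η γ • w := by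
    generalize η γ = A
    induction A using QuotientGroup.induction_on with
    | H A => exact continuous_const_smul A
  have hcomp : p ∘ (fun w : ℍ => η γ • w) = p ∘ id := by
    ext w
    exact ((hp.2.2 w (η γ • w)).mpr ⟨γ, rfl⟩).symm
  have key := hp.1.eq_of_comp_eq hcont continuous_id hcomp z h
  apply FaithfulSMul.eq_of_smul_eq_smul (α := ℍ)
  intro w
  rw [one_smul]
  exact congrFun key w

section

variable {Z : Type*} [TopologicalSpace Z] [MulAction PSL(2, ℝ) Z] [ContinuousSMul PSL(2, ℝ) Z]
  {π : Z → ℍ}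

/-- An equivariant continuous map to the hyperbolic plane is a product projection. -/
lemma exists_homeomorph_of_equivariant (hπ : Continuous π)
    (hequiv : ∀ (A : PSL(2, ℝ)) z, π (A • z) = A • π z) :
    ∃ e : Z ≃ₜ ℍ × {z : Z // π z = UpperHalfPlane.I}, ∀ z, (e z).1 = π z := by
  have h1 : ∀ z, π ((upperSection (π z))⁻¹ • z) = UpperHalfPlane.I := fun z => by
    rw [hequiv, upperSection_inv_smul]
  have h2 : ∀ (w : ℍ) z, π z = UpperHalfPlane.I → π (upperSection w • z) = w := fun w z hz => by
    rw [hequiv, hz, upperSection_smul_I]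
  -- `upperSection` carries the fiber over i to the fiber over any w, continuously in w.
  exact ⟨{
    toFun := fun z => (π z, ⟨(upperSection (π z))⁻¹ • z, h1 z⟩)
    invFun := fun y => upperSection y.1 • y.2.1
    left_inv := fun z => smul_inv_smul _ z
    right_inv := fun ⟨w, z, hz⟩ => Prod.ext (h2 w z hz) (Subtype.ext (by
      simp only [h2 w z hz, inv_smul_smul]))
    continuous_toFun := hπ.prodMk
      (((continuous_upperSection.comp hπ).inv.smul continuous_id).subtype_mk _)
    continuous_invFun := (continuous_upperSection.comp continuous_fst).smul
      (continuous_subtype_val.comp continuous_snd) }, fun _ => rfl⟩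

/-- The quotient of an equivariant bundle over the hyperbolic plane by a discrete group is a fiber
bundle over the quotient of the hyperbolic plane. -/
lemma IsUniformization.isFiberBundle_quotient {S Γ F : Type*} [TopologicalSpace S] [Group Γ]
    {η : Γ →* PSL(2, ℝ)} {p : ℍ → S} (hp : IsUniformization η p) [TopologicalSpace F] [Nonempty F]
    (hequiv : ∀ (A : PSL(2, ℝ)) z, π (A • z) = A • π z)
    (e : Z ≃ₜ ℍ × F) (he : ∀ z, (e z).1 = π z) (s : Setoid Z)
    (hs : ∀ x y : Z, s x y ↔ ∃ γ, η γ • x = y)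
    (πS : Quotient s → S) (hπS : ∀ z, πS (Quotient.mk s z) = p (π z)) :
    IsFiberBundle F πS := by
  have hopen : IsOpenMap (Quotient.mk s) := by
    intro U hU
    have : Quotient.mk s ⁻¹' (Quotient.mk s '' U) = ⋃ γ, (fun x => η γ • x) ⁻¹' U := by
      ext x
      simp only [Set.mem_preimage, Set.mem_image, Set.mem_iUnion]
      constructor
      · rintro ⟨y, hy, hyx⟩
        obtain ⟨γ, rfl⟩ := (hs _ _).mp (Setoid.symm (Quotient.exact hyx))
        exact ⟨γ, hy⟩
      · rintro ⟨γ, hγ⟩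
        exact ⟨_, hγ, Quotient.sound (Setoid.symm ((hs _ _).mpr ⟨γ, rfl⟩))⟩
    refine isOpen_coinduced.mpr ?_
    change IsOpen (Quotient.mk s ⁻¹' _)
    rw [this]
    exact isOpen_iUnion fun γ => hU.preimage (continuous_const_smul _)
  intro b
  obtain ⟨z, rfl⟩ := hp.2.1 b
  -- A local inverse of p suffices, without an evenly covered neighborhood: p is injective on
  -- `φ.source` and the group acts freely, so the part of Z over `φ.source` injects into the
  -- quotient.
  obtain ⟨φ, hz, hφ⟩ := hp.1.isLocalHomeomorph z
  have hinj : ∀ x y : Z, π x ∈ φ.source → π y ∈ φ.source →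
      Quotient.mk s x = Quotient.mk s y → x = y := by
    intro x y hx hy hxy
    obtain ⟨γ, rfl⟩ := (hs _ _).mp (Quotient.exact hxy)
    rw [hequiv] at hy
    have h1 : p (π x) = p (η γ • π x) := (hp.2.2 _ _).mpr ⟨γ, rfl⟩
    rw [hφ] at h1
    have h2 := φ.injOn hx hy h1
    rw [hp.eq_one_of_smul_eq h2.symm, one_smul]
  have heπ : ∀ y, π (e.symm y) = y.1 := fun y => by rw [← he, e.apply_symm_apply]
  let χ := (φ.symm.prod (OpenPartialHomeomorph.refl F)).trans e.symm.toOpenPartialHomeomorph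
  have hχ : χ.source = φ.target ×ˢ Set.univ := by simp [χ]
  have hχπ : ∀ y ∈ χ.source, π (χ y) = φ.symm y.1 := fun y _ => heπ (φ.symm y.1, y.2)
  have hχs : ∀ y ∈ χ.source, π (χ y) ∈ φ.source := fun y hy => by
    rw [hχπ y hy]
    rw [hχ] at hy
    exact φ.map_target hy.1
  have hπSχ : ∀ y ∈ χ.source, πS (Quotient.mk s (χ y)) = y.1 := fun y hy => by
    rw [hπS, hχπ y hy, hφ]
    rw [hχ] at hy
    exact φ.right_inv hy.1
  have hbij : Set.BijOn (fun y => Quotient.mk s (χ y)) χ.source (πS ⁻¹' φ.target) := by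
    refine ⟨fun y hy => ?_, fun y hy y' hy' h => ?_, fun w hw => ?_⟩
    · rw [Set.mem_preimage, hπSχ y hy]
      rw [hχ] at hy
      exact hy.1
    · exact χ.injOn hy hy' (hinj _ _ (hχs y hy) (hχs y' hy') h)
    · obtain ⟨x, rfl⟩ := Quotient.exists_rep w
      rw [Set.mem_preimage, hπS] at hw
      have h1 : p (φ.symm (p (π x))) = p (π x) :=
        (congrFun hφ _).trans (φ.right_inv hw)
      -- For surjectivity, the representative is translated until its base point lies in `φ.source`.
      obtain ⟨γ, hγ⟩ := (hp.2.2 _ _).mp h1.symm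
      have h2 : ((p (π x), (e (η γ • x)).2) : S × F) ∈ χ.source := by
        rw [hχ]; exact ⟨hw, Set.mem_univ _⟩
      refine ⟨_, h2, Quotient.sound (Setoid.symm ((hs _ _).mpr ⟨γ, ?_⟩))⟩
      change η γ • x = e.symm (φ.symm (p (π x)), (e (η γ • x)).2)
      rw [e.eq_symm_apply]
      refine Prod.ext ?_ rfl
      rw [he, hequiv, hγ]
  -- Supplies a default value for the inverse function outside the target.
  have : Nonempty (S × F) := ⟨(p z, Classical.arbitrary F)⟩
  let ψ := OpenPartialHomeomorph.ofContinuousOpenRestrict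
    (Set.BijOn.toPartialEquiv (fun y => Quotient.mk s (χ y)) χ.source (πS ⁻¹' φ.target) hbij)
    (continuous_quotient_mk'.comp_continuousOn χ.continuousOn) (by
      intro U hU
      have h1 : Set.domRestrict χ.source (fun y => Quotient.mk s (χ y)) '' U =
          Quotient.mk s '' (χ '' (Subtype.val '' U)) := by
        simp only [Set.image_image]
        rfl
      change IsOpen (Set.domRestrict χ.source (fun y => Quotient.mk s (χ y)) '' U)
      rw [h1]
      refine hopen _ (χ.isOpen_image_of_subset_source (χ.open_source.isOpenMap_subtype_val U hU) ?_)
      rintro _ ⟨y, -, rfl⟩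
      exact y.2) χ.open_source
  refine ⟨{ toOpenPartialHomeomorph := ψ.symm
            baseSet := φ.target
            open_baseSet := φ.open_target
            source_eq := rfl
            target_eq := hχ
            proj_toFun := fun w hw => ?_ }, ?_⟩
  · have h1 := hπSχ _ (ψ.map_target hw)
    have h2 : Quotient.mk s (χ (ψ.symm w)) = w := ψ.right_inv hw
    rw [h2] at h1
    exact h1.symm
  · change p z ∈ φ.target
    rw [hφ]
    exact φ.map_source hz

end

/-! ### Conjugation of the principal embedding -/

lemma contragredient_inv_smul_smul (g : PSL(3, ℂ)) (H : ℙ ℂ (Fin 3 → ℂ)) :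
    contragredient g⁻¹ • contragredient g • H = H := by
  rw [map_inv, inv_smul_smul]

lemma mem_thickening_smul_iff (g : PSL(3, ℂ)) (x y : Flag) :
    y ∈ thickening (g • x) ↔ g⁻¹ • y ∈ thickening x := by
  have h1 : y.point = (g • x).point ↔ (g⁻¹ • y).point = x.point :=
    (inv_smul_eq_iff (g := g) (a := y.point) (b := x.point)).symm
  have h2 : y.line = (g • x).line ↔ (g⁻¹ • y).line = x.line := by
    change _ = contragredient g • x.line ↔ contragredient g⁻¹ • y.line = _
    rw [map_inv, inv_smul_eq_iff]
  exact or_congr h1 h2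

lemma mem_domain_iff {Γ : Type*} [Group Γ] {η : Γ →* PSL(2, ℝ)} (hη : limitSet η = RP1)
    (g : PSL(3, ℂ)) (ω : Flag) : ω ∈ domain g η ↔ g⁻¹ • ω ∈ stdDomain := by
  simp only [domain, stdDomain, hη, Set.mem_compl_iff, Set.mem_iUnion, principalCurve,
    mem_thickening_smul_iff]

lemma HasDivisors.hasStdDivisors {g : PSL(3, ℂ)} {ω : Flag} {p q r s : P1}
    (h : HasDivisors g ω p q r s) : HasStdDivisors (g⁻¹ • ω) p q r s := by
  have h1 : ∀ x : P1, Incident ω.point (principalCurve g x).line →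
      Incident (g⁻¹ • ω).point (stdPrincipalCurve x).line := fun x hx => by
    have := incident_smul g⁻¹ hx
    change Incident _ (contragredient g⁻¹ • contragredient g • _) at this
    rwa [contragredient_inv_smul_smul] at this
  have h2 : ∀ x : P1, Incident (principalCurve g x).point ω.line →
      Incident (stdPrincipalCurve x).point (g⁻¹ • ω).line := fun x hx => by
    have := incident_smul g⁻¹ hx
    change Incident (g⁻¹ • g • (stdPrincipalCurve x).point) _ at this
    rwa [inv_smul_smul] at this
  obtain ⟨hpq, hrs, hp, hq, hr, hs⟩ := h
  exact ⟨hpq, hrs, h1 p hp, h1 q hq, h2 r hr, h2 s hs⟩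

lemma openStratum_subset_domain {Γ : Type*} [Group Γ] (g : PSL(3, ℂ)) (η : Γ →* PSL(2, ℝ)) :
    openStratum g ⊆ domain g η := by
  rintro ω ⟨p, q, r, s, h⟩ hω
  simp only [Set.mem_iUnion, principalCurve, mem_thickening_smul_iff] at hω
  obtain ⟨t, -, ht⟩ := hω
  exact h.hasStdDivisors.notMem_thickening t ht

lemma inv_smul_principalConj_smul (g : PSL(3, ℂ)) (B : PSL(2, ℂ)) (ω : Flag) :
    g⁻¹ • principalConj g B • ω = principal B • g⁻¹ • ω := by
  change g⁻¹ • (g * principal B * g⁻¹) • ω = _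
  rw [smul_smul, smul_smul]
  congr 1
  group

lemma continuous_principalConj_smul (g : PSL(3, ℂ)) : Continuous fun y : PSL(2, ℝ) × Flag =>
    principalConj g (realToComplex y.1) • y.2 := by
  have h : (fun y : PSL(2, ℝ) × Flag => principalConj g (realToComplex y.1) • y.2) =
      fun y => g • principal (realToComplex y.1) • g⁻¹ • y.2 := by
    ext y : 1
    rw [← inv_smul_principalConj_smul, smul_inv_smul]
  rw [h]
  have h1 : Continuous fun y : PSL(2, ℝ) × Flag => (y.1, g⁻¹ • y.2) :=
    continuous_fst.prodMk ((continuous_smul_flag g⁻¹).comp continuous_snd)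
  exact (continuous_smul_flag g).comp (continuous_real_smul_flag.comp h1)

/-- The flag of the principal curve at the non-real boundary point i: its center is (i, 1)(i, 1)*,
whose real part is the identity matrix, the form of i in the upper half-plane. -/
lemma exists_isProj_I : ∃ ω : Flag, IsProj ω UpperHalfPlane.I := by
  have hv : (![Complex.I, 1] : Fin 2 → ℂ) ≠ 0 := fun h => one_ne_zero (congrFun h 1)
  obtain ⟨h1, h2⟩ := mk_symProd_eq hv hv hv (bracket_self _) (bracket_self _)
  have hω : IsQuadruple _ _ _ _ _ := ⟨hv, hv, hv, hv, h1.symm, h2.symm⟩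
  refine ⟨_, rankOne ![Complex.I, 1], (hω.isCenter_iff _).mpr ⟨psd_rankOne _, ?_, ?_⟩, ?_, ?_, ?_⟩
  · rw [herm_rankOne, bracket_self, zero_mul]
  · rw [herm_rankOne, bracket_self, zero_mul]
  · simp [rankOne]
  · simp [rankOne]
  · simp [rankOne]

/-- The action of `PSL(2, ℝ)` on an invariant set of flags. -/
abbrev invariantAction (g : PSL(3, ℂ)) (Ω : Set Flag) (hinv : ∀ (A : PSL(2, ℝ)) (ω : Ω),
    principalConj g (realToComplex A) • (ω : Flag) ∈ Ω) : MulAction PSL(2, ℝ) Ω where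
  smul A ω := ⟨principalConj g (realToComplex A) • (ω : Flag), hinv A ω⟩
  one_smul ω := Subtype.ext (by
    change principalConj g (realToComplex 1) • (ω : Flag) = ω
    rw [map_one, map_one, one_smul])
  mul_smul A B ω := Subtype.ext (by
    change principalConj g (realToComplex (A * B)) • (ω : Flag) =
      principalConj g (realToComplex A) • principalConj g (realToComplex B) • (ω : Flag)
    rw [map_mul, map_mul, mul_smul])

/-- The translation by `g⁻¹` from a translate of the standard domain to the standard domain. -/
def translateHomeomorph (g : PSL(3, ℂ)) {Ω : Set Flag}
    (hΩ : ∀ ω, ω ∈ Ω ↔ g⁻¹ • ω ∈ stdDomain) : Ω ≃ₜ stdDomain where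
  toFun ω := ⟨g⁻¹ • (ω : Flag), (hΩ _).mp ω.2⟩
  invFun ω := ⟨g • (ω : Flag), (hΩ _).mpr (by rw [inv_smul_smul]; exact ω.2)⟩
  left_inv ω := Subtype.ext (smul_inv_smul g _)
  right_inv ω := Subtype.ext (inv_smul_smul g _)
  continuous_toFun := ((continuous_smul_flag g⁻¹).comp continuous_subtype_val).subtype_mk _
  continuous_invFun := ((continuous_smul_flag g).comp continuous_subtype_val).subtype_mk _

lemma isProperMap_proj_inv_smul (g : PSL(3, ℂ)) {Ω : Set Flag}
    (hΩ : ∀ ω, ω ∈ Ω ↔ g⁻¹ • ω ∈ stdDomain) :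
    IsProperMap fun ω : Ω => proj (g⁻¹ • (ω : Flag)) := by
  have h : (fun ω : Ω => proj (g⁻¹ • (ω : Flag))) =
      stdDomain.domRestrict proj ∘ translateHomeomorph g hΩ := by
    funext ω
    rw [Function.comp_apply, Set.domRestrict_apply]
    rfl
  rw [h]
  exact isProperMap_proj.comp (translateHomeomorph g hΩ).isProperMap

/-- A proper equivariant map to the hyperbolic plane is a trivial bundle with compact fiber, and
its quotient by a discrete group is a bundle. -/
lemma exists_fiber_bundle {Z S Γ : Type*} [TopologicalSpace Z] [MulAction PSL(2, ℝ) Z]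
    [ContinuousSMul PSL(2, ℝ) Z] [TopologicalSpace S] [Group Γ] {η : Γ →* PSL(2, ℝ)} {p : ℍ → S}
    (hp : IsUniformization η p) {π : Z → ℍ} (hπ : IsProperMap π)
    (hequiv : ∀ (A : PSL(2, ℝ)) z, π (A • z) = A • π z)
    (hne : Nonempty {z : Z // π z = UpperHalfPlane.I})
    (s : Setoid Z) (hs : ∀ x y : Z, s x y ↔ ∃ γ, η γ • x = y) :
    CompactSpace {z : Z // π z = UpperHalfPlane.I} ∧
    IsFiberBundle {z : Z // π z = UpperHalfPlane.I} π ∧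
    Nonempty (Z ≃ₜ ℍ × {z : Z // π z = UpperHalfPlane.I}) ∧
    ∃ πS : Quotient s → S, IsFiberBundle {z : Z // π z = UpperHalfPlane.I} πS ∧
      ∀ z, πS (Quotient.mk s z) = p (π z) := by
  obtain ⟨e, he⟩ := exists_homeomorph_of_equivariant hπ.continuous hequiv
  have hlift : ∀ x y : Z, s x y → p (π x) = p (π y) := by
    intro x y hxy
    obtain ⟨γ, rfl⟩ := (hs x y).mp hxy
    exact (hp.2.2 _ _).mpr ⟨γ, (hequiv _ _).symm⟩
  refine ⟨isCompact_iff_compactSpace.mp (hπ.isCompact_preimage isCompact_singleton),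
    isFiberBundle_of_homeomorph e he, ⟨e⟩, Quotient.lift (fun z => p (π z)) hlift,
    hp.isFiberBundle_quotient hequiv e he s hs _ fun _ => rfl, fun _ => rfl⟩

end SL3Fibering

end

open SL3Fibering in
theorem mainTheorem12 {S : Type*} [TopologicalSpace S] [CompactSpace S] (x₀ : S)
    (η : FundamentalGroup S x₀ →* PSL(2, ℝ)) (hη : IsFuchsian η)
    (p : ℍ → S) (hp : IsUniformization η p)
    (g : PSL(3, ℂ)) (ρ : FundamentalGroup S x₀ →* PSL(3, ℂ))
    (hρ : ρ = (principalConj g).comp (realToComplex.comp η)) :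
    openStratum g ⊆ domain g η ∧
    ∃ π : domain g η → ℍ,
      -- `π` extends the map of the open stratum
      (∀ (ω : domain g η) (a b c d : P1), HasDivisors g ω a b c d →
        ∃ x : H3, geodesic a b ∩ geodesic c d = {x} ∧ π ω = orthProj x) ∧
      -- `π` is proper and continuous
      IsProperMap π ∧
      -- the domain is invariant under the continuous action of `PSL(2, ℝ)`, and `π` is equivariant
      Continuous (fun y : PSL(2, ℝ) × domain g η =>
        principalConj g (realToComplex y.1) • (y.2 : Flag)) ∧
      (∀ (A : PSL(2, ℝ)) (ω : domain g η),
        ∃ h : principalConj g (realToComplex A) • (ω : Flag) ∈ domain g η,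
          π ⟨_, h⟩ = A • π ω) ∧
      ∃ (F : Type) (_ : TopologicalSpace F),
        CompactSpace F ∧
        -- the domain is an equivariant fiber bundle over the hyperbolic plane
        IsFiberBundle F π ∧
        -- the domain is a product
        Nonempty (domain g η ≃ₜ ℍ × F) ∧
        -- the quotient is a fiber bundle over the surface, with the projection induced by `π`
        ∃ πS : OrbitQuotient ρ (domain g η) → S,
          IsFiberBundle F πS ∧
          ∀ ω : domain g η, πS (Quotient.mk _ ω) = p (π ω) := by
  -- Since the limit set is the full circle, the domain is the g-translate of `stdDomain`, and the
  -- required map is ω ↦ `proj (g⁻¹ • ω)`.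
  have hdom := mem_domain_iff hp.limitSet_eq g
  have hinv : ∀ (A : PSL(2, ℝ)) (ω : domain g η),
      principalConj g (realToComplex A) • (ω : Flag) ∈ domain g η := fun A ω => by
    rw [hdom, inv_smul_principalConj_smul]
    exact smul_mem_stdDomain ((hdom _).mp ω.2) A
  have hcont : Continuous (fun y : PSL(2, ℝ) × domain g η =>
      principalConj g (realToComplex y.1) • (y.2 : Flag)) :=
    (continuous_principalConj_smul g).comp
      (continuous_fst.prodMk (continuous_subtype_val.comp continuous_snd))
  have hequiv : ∀ (A : PSL(2, ℝ)) (ω : domain g η),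
      proj (g⁻¹ • principalConj g (realToComplex A) • (ω : Flag)) =
        A • proj (g⁻¹ • (ω : Flag)) := fun A ω => by
    rw [inv_smul_principalConj_smul]
    exact proj_smul ((hdom _).mp ω.2) A
  have hne : Nonempty {ω : domain g η // proj (g⁻¹ • (ω : Flag)) = UpperHalfPlane.I} := by
    obtain ⟨ω₀, hω₀⟩ := exists_isProj_I
    refine ⟨⟨⟨g • ω₀, (hdom _).mpr ?_⟩, ?_⟩⟩
    · rw [inv_smul_smul]
      exact (mem_stdDomain_iff _).mpr ⟨_, hω₀⟩
    · rw [inv_smul_smul, hω₀.proj_eq]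
  let := invariantAction g (domain g η) hinv
  have : ContinuousSMul PSL(2, ℝ) (domain g η) := ⟨hcont.subtype_mk _⟩
  have hs : ∀ x y : domain g η, orbitSetoid ρ (domain g η) x y ↔ ∃ γ, η γ • x = y := by
    intro x y
    subst hρ
    exact exists_congr fun γ => (Subtype.ext_iff (a1 := η γ • x) (a2 := y)).symm
  have hproper := isProperMap_proj_inv_smul g hdom
  have hbundle := exists_fiber_bundle hp hproper hequiv hne _ hs
  exact ⟨openStratum_subset_domain g η, _,
    fun ω a b c d h => h.hasStdDivisors.exists_inter_eq, hproper, hcont,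
    fun A ω => ⟨hinv A ω, hequiv A ω⟩, _, _, hbundle⟩
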